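/- Let $k,m,n,\ell,q,Q,s,T$ be non-negative integers with $m\ge 1$, $q\le 2^m$, $T=s(2m-1)$, and put $\alpha=\ell+m(q+1)+T$; assume $\alpha+n\le k$. **The cipher.** A random oracle assigns to each pair $(R,r)$ with $R\in\{0,1\}^{m-1}$, $r\in\{1,\dots,T\}$ an independent answer $(P,\mathcal S)$, where $P=(P_1,\dots,P_n)$ consists of $n$ independent uniform samples (with replacement) from $\{1,\dots,k\}$ and $\mathcal S$ is an independent uniformly random subset of $\{1,\dots,n\}$. For a key $K\in\{0,1\}^k$ let $F_K(R,r)=\bigoplus_{i\in\mathcal S}K[P_i]$. Round $r$ of the Thorp shuffle maps a string $LR\in\{0,1\}^m$, with $L$ of length $1$ and $R$ of length $m-1$, to $RL'$, where $L'=L\oplus F_K(R,r)$. The cipher $X_T$ is the composition of rounds $1,\dots,T$. **The adversary.** A (possibly randomized) adversary first makes at most $Q$ adaptive calls to the random oracle and then chooses a leakage function $\Phi:\{0,1\}^k\to\{0,1\}^\ell$. A uniformly random key $K\in\{0,1\}^k$ and uniformly random distinct messages $M_1,\dots,M_q\in\{0,1\}^m$ are drawn, independently of each other and of the oracle. In world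 1, $C_i=X_T(M_i)$; in world 0, $C_i=\pi(M_i)$ for an independent uniformly random permutation $\pi$ of $\{0,1\}^m$. In either world the adversary is then given the leakage $\Phi(K)$, the pairs $(M_1,C_1),\dots,(M_q,C_q)$ and access to all answers of the random oracle (in particular those that the cipher uses; it is not told on which inputs the cipher called the oracle), and it guesses the world. Its advantage is $\mathbf{Adv}(\mathcal A)=\mathbb P_1(\mathcal A\text{ guesses }1)-\mathbb P_0(\mathcal A\text{ guesses }1)$, and $\mathbf{MaxAdv}_{Q,q}$ is the supremum of $\mathbf{Adv}(\mathcal A)$ over all such adversaries. **Theorem.** $$\mathbf{MaxAdv}_{Q,q}\le \frac{q}{s+1}\left(\frac{4mq}{2^m}\right)^s+\frac{qT}{2}\left[h^{-1}\left(1-\frac{\alpha+n}{k}\right)\right]^{n/2}+\frac{qQ}{2^{m-1}}+\frac{qT}{2^m},$$ where $h(p)=p\log_2\frac1p+(1-p)\log_2\frac1{1-p}$ (with $0\log_2\frac10=0$) and $h^{-1}:[0,1]\to[\tfrac12,1]$ is the inverse of the restriction of $h$ to $[\tfrac12,1]$. -/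

import Mathlib

noncomputable section

namespace BigKeyThorp

/-- Bits are elements of `ZMod 2`, so that XOR is addition. -/
abbrev Bits (j : ℕ) : Type := Fin j → ZMod 2

/-- An input `(R, r)` of the random oracle: `m - 1` bits and a round number
(rounds `1, …, T` are numbered `0, …, T - 1`). -/
abbrev Query (m T : ℕ) : Type := Bits (m - 1) × Fin T

/-- An answer `(P, S)` of the random oracle: `n` probes into the key and a set of probe indices. -/
abbrev Answer (k n : ℕ) : Type := (Fin n → Fin k) × Finset (Fin n)

/-- A full table of the random oracle. A uniformly random table has independent answers, each with
`P` uniform (`n` samples with replacement) and `S` an independent uniform subset. -/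
abbrev Oracle (k m n T : ℕ) : Type := Query m T → Answer k n

/-- The rightmost `m - 1` bits of a message. -/
def right {m : ℕ} (x : Bits m) : Bits (m - 1) := fun i => x ⟨i + 1, by omega⟩

/-- One Thorp shuffle with round function `F`: `L R ↦ R L'` with `L' = L ⊕ F R`,
where `L` is the first bit. -/
def thorpRound {m : ℕ} (F : Bits (m - 1) → ZMod 2) (x : Bits m) : Bits m := fun i =>
  if h : (i : ℕ) + 1 < m then x ⟨i + 1, h⟩
  else x ⟨0, by omega⟩ + F (right x)

/-- The big-key pseudorandom function: the XOR of the subsequence of the subkey selected by `S`. -/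
def bigKeyPRF {k m n T : ℕ} (O : Oracle k m n T) (K : Bits k) (R : Bits (m - 1)) (r : Fin T) :
    ZMod 2 :=
  ∑ i ∈ (O (R, r)).2, K ((O (R, r)).1 i)

/-- The cipher: `T` Thorp shuffles, the `r`-th with round function `bigKeyPRF O K · r`. -/
def cipher {k m n T : ℕ} (O : Oracle k m n T) (K : Bits k) (x : Bits m) : Bits m :=
  Fin.foldl T (fun y r => thorpRound (fun R => bigKeyPRF O K R r) y) x

/-- Deterministic adaptive algorithms that make at most `Q` calls to an oracle `I → A` and
return an element of `β`. -/
inductive OracleAlg (I A β : Type) : ℕ → Type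
  | ret {Q : ℕ} (b : β) : OracleAlg I A β Q
  | ask {Q : ℕ} (x : I) (next : A → OracleAlg I A β Q) : OracleAlg I A β (Q + 1)

/-- The value returned by an algorithm that interacts with the oracle `O`. -/
def OracleAlg.run {I A β : Type} (O : I → A) : {Q : ℕ} → OracleAlg I A β Q → β
  | _, .ret b => b
  | _, .ask x next => (next (O x)).run O

/-- What the adversary sees before guessing: the leakage, the plaintext-ciphertext pairs, and the
answers of the random oracle, in particular all those which the cipher uses. -/
structure View (k m n ℓ q T : ℕ) : Type where
  leakage : Bits ℓ
  pairs : Fin q → Bits m × Bits m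
  oracle : Oracle k m n T

/-- A deterministic adversary makes at most `Q` adaptive oracle calls and then, depending on the
answers, fixes a leakage function and a rule for guessing the world (`true` is world 1). -/
abbrev DetAdversary (k m n ℓ q Q T : ℕ) : Type :=
  OracleAlg (Query m T) (Answer k n) ((Bits k → Bits ℓ) × (View k m n ℓ q T → Bool)) Q

/-- An adversary is a randomized choice of a deterministic one. -/
abbrev Adversary (k m n ℓ q Q T : ℕ) : Type := PMF (DetAdversary k m n ℓ q Q T)

theorem nonempty_messages {m q : ℕ} (hq : q ≤ 2 ^ m) : Nonempty (Fin q ↪ Bits m) := by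
  apply Function.Embedding.nonempty_of_card_le
  simpa [ZMod.card] using hq

/-- Uniformly random distinct messages `M₁, …, M_q`. -/
def randomMessages {m q : ℕ} (hq : q ≤ 2 ^ m) : PMF (Fin q ↪ Bits m) :=
  haveI := nonempty_messages hq
  PMF.uniformOfFintype (Fin q ↪ Bits m)

/-- The adversary's guess in world 1, where `Cᵢ` is the encryption of `Mᵢ`. -/
def world1 {k m n ℓ q Q T : ℕ} [NeZero k] (hq : q ≤ 2 ^ m) (𝒜 : Adversary k m n ℓ q Q T) :
    PMF Bool :=
  𝒜.bind fun A =>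
  (PMF.uniformOfFintype (Oracle k m n T)).bind fun O =>
  (PMF.uniformOfFintype (Bits k)).bind fun K =>
  (randomMessages hq).bind fun M =>
  PMF.pure ((A.run O).2
    { leakage := (A.run O).1 K
      pairs := fun i => (M i, cipher O K (M i))
      oracle := O })

/-- The adversary's guess in world 0, where `Cᵢ = π Mᵢ` for a uniformly random permutation `π`. -/
def world0 {k m n ℓ q Q T : ℕ} [NeZero k] (hq : q ≤ 2 ^ m) (𝒜 : Adversary k m n ℓ q Q T) :
    PMF Bool :=
  𝒜.bind fun A =>
  (PMF.uniformOfFintype (Oracle k m n T)).bind fun O =>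
  (PMF.uniformOfFintype (Bits k)).bind fun K =>
  (randomMessages hq).bind fun M =>
  (PMF.uniformOfFintype (Equiv.Perm (Bits m))).bind fun π =>
  PMF.pure ((A.run O).2
    { leakage := (A.run O).1 K
      pairs := fun i => (M i, π (M i))
      oracle := O })

/-- The advantage `P₁(𝒜(1) = 1) - P₀(𝒜(0) = 1)`. -/
def adv {k m n ℓ q Q T : ℕ} [NeZero k] (hq : q ≤ 2 ^ m) (𝒜 : Adversary k m n ℓ q Q T) : ℝ :=
  (world1 hq 𝒜 true).toReal - (world0 hq 𝒜 true).toReal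

/-- The maximum advantage over all adversaries with `ℓ` bits of leakage, `q` pairs and
at most `Q` oracle calls. -/
def maxAdv (k m n ℓ q Q T : ℕ) [NeZero k] (hq : q ≤ 2 ^ m) : ℝ :=
  ⨆ 𝒜 : Adversary k m n ℓ q Q T, adv hq 𝒜

/-- The supremum in `maxAdv` is over a bounded family, so it is a true supremum. -/
theorem adv_le_maxAdv {k m n ℓ q Q T : ℕ} [NeZero k] (hq : q ≤ 2 ^ m)
    (𝒜 : Adversary k m n ℓ q Q T) : adv hq 𝒜 ≤ maxAdv k m n ℓ q Q T hq := by
  refine le_ciSup (f := fun 𝒜 : Adversary k m n ℓ q Q T => adv hq 𝒜) ⟨1, ?_⟩ 𝒜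
  rintro _ ⟨ℬ, rfl⟩
  have h1 : (world1 hq ℬ true).toReal ≤ 1 := by
    simpa using ENNReal.toReal_mono ENNReal.one_ne_top (PMF.coe_le_one (world1 hq ℬ) true)
  have h0 : 0 ≤ (world0 hq ℬ true).toReal := ENNReal.toReal_nonneg
  simp only [adv]
  linarith

/-- The entropy, base 2, of a Bernoulli(`p`) random variable. -/
def h (p : ℝ) : ℝ := p * Real.logb 2 (1 / p) + (1 - p) * Real.logb 2 (1 / (1 - p))

/-- The inverse of the restriction of `h` to `[1/2, 1]`; meaningful on `[0, 1]`. -/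
def hInv : ℝ → ℝ := Function.invFunOn h (Set.Icc (1 / 2) 1)

end BigKeyThorp

end

/-!
Given the leakage and the ciphertexts, the key is uniform on a fibre of the map
`K ↦ (Φ K, C₁, …, C_q)`. Averaged over the probe, the character of the difference `Z` of two keys
is (fraction of zeros of `Z`) ^ `n`, so the squared bias of a key parity over a set of keys is
controlled by how many keys of the set can be close to a given one. An exponential tilt bounds that
number through the entropy: on a set of at least `2 ^ (k - α)` keys the bias is at most
`hInv (1 - (α + n) / k) ^ (n / 2)`. All fibres smaller than this together carry mass at most
`2 ^ (ℓ + m q) / 2 ^ α`.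

The cipher is turned into a Thorp shuffle with truly random round functions by exchanging key
parities for fresh bits, one explored point of the message trajectories at a time. A parity whose
probe is still unread costs the bias above. A point whose probe was already read costs `1`, but
the messages are random, so in a given round a given message is at such a point with probability
the number of points read in that round over `2 ^ (m - 1)`.

With random round functions, reveal the messages one at a time and couple the message `l` with a
uniform one avoiding the previous `l`. A block of `2m - 1` rounds fails to couple them with
probability at most `4ml / 2 ^ m`, and the sum over `l < q` of the `s`-th powers is at most
`q / (s + 1) * (4mq / 2 ^ m) ^ s`.
-/

noncomputable section

namespace BigKeyThorp

open Finset
open scoped BigOperators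

/-! ### Binary entropy and its inverse -/

theorem h_eq_binEntropy_div (p : ℝ) : h p = Real.binEntropy p / Real.log 2 := by
  simp only [h, Real.binEntropy, Real.logb, one_div]
  ring

theorem mem_image_h {y : ℝ} (hy : y ∈ Set.Icc (0 : ℝ) 1) : y ∈ h '' Set.Icc (1 / 2) 1 := by
  have h_eq : h = fun p => Real.binEntropy p / Real.log 2 := funext h_eq_binEntropy_div
  have h_half : h (1 / 2) = 1 := by
    rw [h_eq_binEntropy_div, one_div, Real.binEntropy_two_inv,
      div_self (Real.log_pos one_lt_two).ne']
  have h_one : h 1 = 0 := by rw [h_eq_binEntropy_div, Real.binEntropy_one, zero_div]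
  have h_cont : ContinuousOn h (Set.Icc (1 / 2) 1) := by rw [h_eq]; fun_prop
  refine intermediate_value_Icc' (by norm_num) h_cont ?_
  rwa [h_half, h_one]

theorem hInv_mem_Icc {y : ℝ} (hy : y ∈ Set.Icc (0 : ℝ) 1) : hInv y ∈ Set.Icc (1 / 2 : ℝ) 1 :=
  Function.invFunOn_mem (mem_image_h hy)

theorem h_hInv {y : ℝ} (hy : y ∈ Set.Icc (0 : ℝ) 1) : h (hInv y) = y :=
  Function.invFunOn_eq (mem_image_h hy)

theorem h_strictAntiOn : StrictAntiOn h (Set.Icc (1 / 2) 1) := by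
  intro p hp p' hp' hlt
  rw [h_eq_binEntropy_div, h_eq_binEntropy_div]
  rw [one_div] at hp hp'
  exact div_lt_div_of_pos_right (Real.binEntropy_strictAntiOn hp hp' hlt) (Real.log_pos one_lt_two)

theorem le_hInv {θ y : ℝ} (hy : y ∈ Set.Icc (0 : ℝ) 1) (hθ : θ ≤ 1)
    (hle : 1 / 2 ≤ θ → y ≤ h θ) : θ ≤ hInv y := by
  have hmem := hInv_mem_Icc hy
  by_contra! hlt
  have hhalf : 1 / 2 ≤ θ := hmem.1.trans hlt.le
  have hanti : h θ < h (hInv y) := h_strictAntiOn hmem ⟨hhalf, hθ⟩ hlt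
  rw [h_hInv hy] at hanti
  exact (hle hhalf).not_gt hanti

theorem entropyRate_mem_Icc {k α n : ℕ} (hk : α + n ≤ k) :
    1 - ((α : ℝ) + n) / k ∈ Set.Icc (0 : ℝ) 1 := by
  have hk' : ((α : ℝ) + n) ≤ k := by exact_mod_cast hk
  exact ⟨sub_nonneg.2 (div_le_one_of_le₀ hk' (by positivity)), sub_le_self _ (by positivity)⟩

/-! ### Moments of the fraction of zeros in a large set of keys -/

section ZeroFrac

variable {k : ℕ}

/-- The fraction of zero bits of `Z`: the probability that a uniform probe into `Z` reads `0`. -/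
def zeroFrac (Z : Bits k) : ℝ := (univ.filter fun i => Z i = 0).dens

theorem zeroFrac_nonneg (Z : Bits k) : 0 ≤ zeroFrac Z := by
  unfold zeroFrac
  positivity

theorem zeroFrac_le_one (Z : Bits k) : zeroFrac Z ≤ 1 := by
  unfold zeroFrac
  exact_mod_cast dens_le_one

theorem card_zeros (Z : Bits k) : (#{i | Z i = 0} : ℝ) = k * zeroFrac Z := by
  simpa [zeroFrac] using
    (natCast_card_mul_nnratCast_dens (𝕜 := ℝ) (univ.filter fun i => Z i = 0)).symm

theorem card_nonzeros (Z : Bits k) : (#{i | ¬Z i = 0} : ℝ) = k * (1 - zeroFrac Z) := by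
  have hcard : (#{i | Z i = 0} : ℝ) + #{i | ¬Z i = 0} = k := by
    rw [← Nat.cast_add, card_filter_add_card_filter_not, card_univ, Fintype.card_fin]
  linear_combination hcard - card_zeros Z

theorem eq_zero_of_zeroFrac_eq_one {Z : Bits k} (hZ : zeroFrac Z = 1) : Z = 0 := by
  have hcard : #{i | ¬Z i = 0} = 0 := by
    have := card_nonzeros Z
    rw [hZ, sub_self, mul_zero] at this
    exact_mod_cast this
  rw [card_eq_zero, filter_eq_empty_iff] at hcard
  exact funext fun i => not_not.1 (hcard (mem_univ i))

theorem zeroFrac_pow_le_one (Z : Bits k) (j : ℕ) : zeroFrac Z ^ j ≤ 1 :=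
  pow_le_one₀ (zeroFrac_nonneg Z) (zeroFrac_le_one Z)

theorem sum_zeroFrac_pow_antitone (𝒦 : Finset (Bits k)) :
    Antitone fun j => ∑ Z ∈ 𝒦, zeroFrac Z ^ j := fun _ _ hij =>
  sum_le_sum fun Z _ => pow_le_pow_of_le_one (zeroFrac_nonneg Z) (zeroFrac_le_one Z) hij

/-- The probability of `Z` when its bits are independent and vanish with probability `θ`. -/
def bernoulliWeight (θ : ℝ) (Z : Bits k) : ℝ := ∏ i, if Z i = 0 then θ else 1 - θ

theorem bernoulliWeight_nonneg {θ : ℝ} (hθ : θ ∈ Set.Icc (0 : ℝ) 1) (Z : Bits k) :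
    0 ≤ bernoulliWeight θ Z :=
  prod_nonneg fun i _ => by split_ifs <;> linarith [hθ.1, hθ.2]

theorem sum_zmod_two {M : Type*} [AddCommMonoid M] (f : ZMod 2 → M) : ∑ b, f b = f 0 + f 1 :=
  Fin.sum_univ_two f

theorem sum_bernoulliWeight (k : ℕ) (θ : ℝ) : ∑ Z : Bits k, bernoulliWeight θ Z = 1 := by
  simp only [bernoulliWeight]
  rw [← Fintype.prod_sum fun (_ : Fin k) (b : ZMod 2) => if b = 0 then θ else 1 - θ]
  simp [sum_zmod_two]

theorem bernoulliWeight_eq_exp {θ : ℝ} (hθ : θ ∈ Set.Ioo (0 : ℝ) 1) (Z : Bits k) :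
    bernoulliWeight θ Z = Real.exp (-(k * Real.binEntropy θ)) *
      Real.exp ((zeroFrac Z - θ) * (k * (Real.log θ - Real.log (1 - θ)))) := by
  have hexp : ∀ i, (if Z i = 0 then θ else 1 - θ) =
      Real.exp (if Z i = 0 then Real.log θ else Real.log (1 - θ)) := fun i => by
    split_ifs <;> rw [Real.exp_log] <;> linarith [hθ.1, hθ.2]
  simp only [bernoulliWeight, hexp]
  rw [← Real.exp_sum, ← Real.exp_add, sum_ite, sum_const, sum_const, nsmul_eq_mul, nsmul_eq_mul,
    card_zeros, card_nonzeros, Real.binEntropy, Real.log_inv, Real.log_inv]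
  congr 1
  ring

/-- The tangent line of `exp` at the mean `θ`; its linear term averages to zero below. -/
theorem tangent_le_bernoulliWeight {θ : ℝ} (hθ : θ ∈ Set.Ioo (0 : ℝ) 1) (Z : Bits k) :
    Real.exp (-(k * Real.binEntropy θ)) *
      (1 + (zeroFrac Z - θ) * (k * (Real.log θ - Real.log (1 - θ)))) ≤ bernoulliWeight θ Z := by
  rw [bernoulliWeight_eq_exp hθ, add_comm 1]
  gcongr
  exact Real.add_one_le_exp _

section Weights

variable {𝒦 : Finset (Bits k)} {w : Bits k → ℝ} {θ : ℝ}

theorem sum_weight_le_exp_binEntropy_of_lt_one (hw0 : ∀ Z ∈ 𝒦, 0 ≤ w Z) (hw1 : ∀ Z ∈ 𝒦, w Z ≤ 1)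
    (hθ : θ ∈ Set.Ioo (0 : ℝ) 1) (hmean : ∑ Z ∈ 𝒦, w Z * zeroFrac Z = θ * ∑ Z ∈ 𝒦, w Z) :
    ∑ Z ∈ 𝒦, w Z ≤ Real.exp (k * Real.binEntropy θ) := by
  set c := Real.exp (-(k * Real.binEntropy θ)) with hc
  set d : ℝ := k * (Real.log θ - Real.log (1 - θ))
  have hnonneg := bernoulliWeight_nonneg (k := k) (Set.Ioo_subset_Icc_self hθ)
  suffices c * ∑ Z ∈ 𝒦, w Z ≤ 1 by
    rwa [hc, Real.exp_neg, inv_mul_le_one₀ (Real.exp_pos _)] at this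
  calc c * ∑ Z ∈ 𝒦, w Z
      = c * ∑ Z ∈ 𝒦, w Z + c * d * (∑ Z ∈ 𝒦, w Z * zeroFrac Z - θ * ∑ Z ∈ 𝒦, w Z) := by
        rw [hmean, sub_self, mul_zero, add_zero]
    _ = ∑ Z ∈ 𝒦, w Z * (c * (1 + (zeroFrac Z - θ) * d)) := by
        simp only [mul_sum, ← sum_sub_distrib, ← sum_add_distrib]
        exact sum_congr rfl fun Z _ => by ring
    _ ≤ ∑ Z ∈ 𝒦, bernoulliWeight θ Z := sum_le_sum fun Z hZ =>
        (mul_le_mul_of_nonneg_left (tangent_le_bernoulliWeight hθ Z) (hw0 Z hZ)).trans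
          (mul_le_of_le_one_left (hnonneg Z) (hw1 Z hZ))
    _ ≤ ∑ Z, bernoulliWeight θ Z := sum_le_univ_sum_of_nonneg hnonneg
    _ = 1 := sum_bernoulliWeight k θ

theorem sum_weight_le_one_of_mean_eq (hw0 : ∀ Z ∈ 𝒦, 0 ≤ w Z) (hw1 : ∀ Z ∈ 𝒦, w Z ≤ 1)
    (hmean : ∑ Z ∈ 𝒦, w Z * zeroFrac Z = ∑ Z ∈ 𝒦, w Z) : ∑ Z ∈ 𝒦, w Z ≤ 1 := by
  have hsum : ∑ Z ∈ 𝒦, w Z * (1 - zeroFrac Z) = 0 := by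
    simp only [mul_sub, mul_one, sum_sub_distrib, hmean, sub_self]
  have hzero := (sum_eq_zero_iff_of_nonneg fun Z hZ =>
    mul_nonneg (hw0 Z hZ) (sub_nonneg.2 (zeroFrac_le_one Z))).1 hsum
  have hsupp : ∀ Z ∈ 𝒦, Z ≠ 0 → w Z = 0 := fun Z hZ hne =>
    (mul_eq_zero.1 (hzero Z hZ)).resolve_right fun hfrac =>
      hne (eq_zero_of_zeroFrac_eq_one (sub_eq_zero.1 hfrac).symm)
  by_cases h0 : (0 : Bits k) ∈ 𝒦
  · rw [sum_eq_single_of_mem 0 h0 hsupp]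
    exact hw1 0 h0
  · rw [sum_eq_zero fun Z hZ => hsupp Z hZ (ne_of_mem_of_not_mem hZ h0)]
    exact zero_le_one

theorem sum_weight_le_exp_binEntropy (hw0 : ∀ Z ∈ 𝒦, 0 ≤ w Z) (hw1 : ∀ Z ∈ 𝒦, w Z ≤ 1)
    (hθ : θ ∈ Set.Ioc (0 : ℝ) 1) (hmean : ∑ Z ∈ 𝒦, w Z * zeroFrac Z = θ * ∑ Z ∈ 𝒦, w Z) :
    ∑ Z ∈ 𝒦, w Z ≤ Real.exp (k * Real.binEntropy θ) := by
  rcases hθ.2.lt_or_eq with hlt | rfl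
  · exact sum_weight_le_exp_binEntropy_of_lt_one hw0 hw1 ⟨hθ.1, hlt⟩ hmean
  · rw [Real.binEntropy_one, mul_zero, Real.exp_zero]
    exact sum_weight_le_one_of_mean_eq hw0 hw1 (by rwa [one_mul] at hmean)

end Weights

theorem le_h_of_two_rpow_le [NeZero k] {y θ : ℝ}
    (hle : (2 : ℝ) ^ (y * k) ≤ Real.exp (k * Real.binEntropy θ)) : y ≤ h θ := by
  have hk : (0 : ℝ) < k := Nat.cast_pos.2 (NeZero.pos k)
  have hlog := Real.log_le_log (by positivity) hle
  rw [Real.log_exp, Real.log_rpow two_pos] at hlog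
  rw [h_eq_binEntropy_div, le_div_iff₀ (Real.log_pos one_lt_two)]
  nlinarith

theorem sum_zeroFrac_pow_succ_le [NeZero k] {y : ℝ} (hy : y ∈ Set.Icc (0 : ℝ) 1)
    {𝒦 : Finset (Bits k)} {j : ℕ} (hlarge : (2 : ℝ) ^ (y * k) ≤ ∑ Z ∈ 𝒦, zeroFrac Z ^ j) :
    ∑ Z ∈ 𝒦, zeroFrac Z ^ (j + 1) ≤ hInv y * ∑ Z ∈ 𝒦, zeroFrac Z ^ j := by
  set A := ∑ Z ∈ 𝒦, zeroFrac Z ^ j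
  set B := ∑ Z ∈ 𝒦, zeroFrac Z ^ (j + 1) with hB
  have hA : 0 < A := lt_of_lt_of_le (by positivity) hlarge
  have hmean_le : B / A ≤ 1 :=
    div_le_one_of_le₀ (sum_zeroFrac_pow_antitone 𝒦 j.le_succ) hA.le
  suffices B / A ≤ hInv y from (div_le_iff₀ hA).1 this
  refine le_hInv hy hmean_le fun hhalf => le_h_of_two_rpow_le (k := k) (hlarge.trans ?_)
  refine sum_weight_le_exp_binEntropy (fun Z _ => pow_nonneg (zeroFrac_nonneg Z) j)
    (fun Z _ => zeroFrac_pow_le_one Z j) ⟨by linarith, hmean_le⟩ ?_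
  simp only [← pow_succ]
  rw [← hB, div_mul_cancel₀ B hA.ne']

theorem sum_zeroFrac_pow_le [NeZero k] {α n : ℕ} (hk : α + n ≤ k) {𝒦 : Finset (Bits k)}
    (h𝒦 : (2 : ℝ) ^ k ≤ 2 ^ α * #𝒦) :
    ∑ Z ∈ 𝒦, zeroFrac Z ^ n ≤ #𝒦 * hInv (1 - ((α : ℝ) + n) / k) ^ n := by
  set y : ℝ := 1 - ((α : ℝ) + n) / k with hy
  have hy_mem : y ∈ Set.Icc (0 : ℝ) 1 := entropyRate_mem_Icc hk
  have hhalf : 1 / 2 ≤ hInv y := (hInv_mem_Icc hy_mem).1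
  rcases le_or_gt (∑ Z ∈ 𝒦, zeroFrac Z ^ n) (#𝒦 * (1 / 2 : ℝ) ^ n) with hsmall | hbig
  · exact hsmall.trans (by gcongr)
  have hthreshold : (2 : ℝ) ^ (y * k) ≤ #𝒦 * (1 / 2 : ℝ) ^ n := by
    have hk0 : (k : ℝ) ≠ 0 := Nat.cast_ne_zero.2 (NeZero.ne k)
    have hexponent : y * k = k - α - n := by rw [hy]; field_simp; ring
    rw [hexponent, Real.rpow_sub two_pos, Real.rpow_sub two_pos, Real.rpow_natCast,
      Real.rpow_natCast, Real.rpow_natCast, one_div, inv_pow, ← div_eq_mul_inv]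
    gcongr
    rwa [div_le_iff₀' (by positivity)]
  have hstep : ∀ j < n, ∑ Z ∈ 𝒦, zeroFrac Z ^ (j + 1) ≤ hInv y * ∑ Z ∈ 𝒦, zeroFrac Z ^ j :=
    fun j hj => sum_zeroFrac_pow_succ_le hy_mem
      (hthreshold.trans (hbig.le.trans (sum_zeroFrac_pow_antitone 𝒦 hj.le)))
  have hgeom := le_geom (u := fun j => ∑ Z ∈ 𝒦, zeroFrac Z ^ j) (by linarith) n hstep
  simpa [mul_comm] using hgeom

end ZeroFrac

/-! ### The bias of subset parities of a large set of keys -/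

/-- The nontrivial character of `ZMod 2`. -/
def sign : AddChar (ZMod 2) ℝ := AddChar.zmodChar 2 (ζ := -1) (by norm_num)

theorem sign_one : sign 1 = -1 := by
  rw [sign, AddChar.zmodChar_apply, ZMod.val_one, pow_one]

theorem zmod_two_cases : ∀ b : ZMod 2, b = 0 ∨ b = 1 := by decide

theorem sign_sum {ι : Type*} (s : Finset ι) (f : ι → ZMod 2) :
    sign (∑ i ∈ s, f i) = ∏ i ∈ s, sign (f i) :=
  map_prod sign.toMonoidHom (fun i => Multiplicative.ofAdd (f i)) s

theorem abs_sign (b : ZMod 2) : |sign b| = 1 := by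
  rcases zmod_two_cases b with rfl | rfl <;> simp [sign_one]

theorem one_add_sign (b : ZMod 2) : 1 + sign b = 2 * if b = 0 then 1 else 0 := by
  rcases zmod_two_cases b with rfl | rfl <;> norm_num [sign_one]

/-- The bit `⨁_{i ∈ S} K[P_i]` that the oracle answer `a = (P, S)` extracts from the key. -/
def parity {k n : ℕ} (a : Answer k n) (K : Bits k) : ZMod 2 := ∑ i ∈ a.2, K (a.1 i)

/-- Bounds the advantage of a test with `N` outcomes in telling a subset parity of the key from a
uniform bit. The second summand accounts for the outcomes whose fibre has fewer than `2 ^ (k - α)`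
keys. -/
def parityCost (k α n N : ℕ) : ℝ :=
  (hInv (1 - ((α : ℝ) + n) / k) ^ ((n : ℝ) / 2) + N / 2 ^ α) / 2

section Parity

variable {k α n : ℕ}

theorem parity_add (a : Answer k n) (K K' : Bits k) :
    parity a (K + K') = parity a K + parity a K' := by
  simp only [parity, Pi.add_apply, sum_add_distrib]

theorem hInv_entropyRate_nonneg (hk : α + n ≤ k) : 0 ≤ hInv (1 - ((α : ℝ) + n) / k) :=
  le_trans (by norm_num) (hInv_mem_Icc (entropyRate_mem_Icc hk)).1

theorem parityCost_nonneg (hk : α + n ≤ k) (N : ℕ) : 0 ≤ parityCost k α n N := by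
  have := hInv_entropyRate_nonneg hk
  unfold parityCost
  positivity

theorem sum_sign_parity (P : Fin n → Fin k) (Z : Bits k) :
    ∑ S : Finset (Fin n), sign (parity (P, S) Z) = ∏ i, (1 + sign (Z (P i))) := by
  rw [prod_one_add, powerset_univ]
  exact sum_congr rfl fun S _ => sign_sum _ _

theorem sum_one_add_sign (Z : Bits k) : ∑ j, (1 + sign (Z j)) = 2 * (k * zeroFrac Z) := by
  rw [← card_zeros, card_filter]
  push_cast
  rw [mul_sum]
  exact sum_congr rfl fun j _ => one_add_sign _

section NonemptyKey

variable [NeZero k]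

theorem expect_sign_parity (Z : Bits k) :
    𝔼 a : Answer k n, sign (parity a Z) = zeroFrac Z ^ n := by
  have hk : (k : ℝ) ≠ 0 := Nat.cast_ne_zero.2 (NeZero.ne k)
  have hcard : (Fintype.card (Answer k n) : ℝ) = (2 * k) ^ n := by
    simp [mul_pow, mul_comm]
  rw [Fintype.expect_eq_sum_div_card, Fintype.sum_prod_type, hcard]
  simp only [sum_sign_parity]
  rw [← Fintype.sum_pow fun j => 1 + sign (Z j), sum_one_add_sign, ← div_pow]
  field_simp

theorem expect_sq_sum_sign_parity (𝒦 : Finset (Bits k)) :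
    𝔼 a : Answer k n, (∑ K ∈ 𝒦, sign (parity a K)) ^ 2 =
      ∑ K ∈ 𝒦, ∑ K' ∈ 𝒦, zeroFrac (K + K') ^ n := by
  simp only [sq, sum_mul_sum, ← AddChar.map_add_eq_mul, ← parity_add, expect_sum_comm,
    expect_sign_parity]

theorem sum_zeroFrac_add_pow_le (hk : α + n ≤ k) {𝒦 : Finset (Bits k)}
    (h𝒦 : (2 : ℝ) ^ k ≤ 2 ^ α * #𝒦) (K : Bits k) :
    ∑ K' ∈ 𝒦, zeroFrac (K + K') ^ n ≤ #𝒦 * hInv (1 - ((α : ℝ) + n) / k) ^ n := by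
  have hle := sum_zeroFrac_pow_le hk (𝒦 := 𝒦.map (addLeftEmbedding K)) (by rwa [card_map])
  rwa [sum_map, card_map] at hle

theorem expect_abs_sum_sign_parity_le_of_large (hk : α + n ≤ k) {𝒦 : Finset (Bits k)}
    (h𝒦 : (2 : ℝ) ^ k ≤ 2 ^ α * #𝒦) :
    𝔼 a : Answer k n, |∑ K ∈ 𝒦, sign (parity a K)| ≤
      #𝒦 * hInv (1 - ((α : ℝ) + n) / k) ^ ((n : ℝ) / 2) := by
  set H := hInv (1 - ((α : ℝ) + n) / k)
  have hH : 0 ≤ H := hInv_entropyRate_nonneg hk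
  have hpow : (H ^ ((n : ℝ) / 2)) ^ 2 = H ^ n := by
    rw [← Real.rpow_mul_natCast hH, Nat.cast_ofNat, div_mul_cancel₀ _ two_ne_zero,
      Real.rpow_natCast]
  refine le_of_sq_le_sq ?_ (by positivity)
  calc (𝔼 a : Answer k n, |∑ K ∈ 𝒦, sign (parity a K)|) ^ 2
      ≤ 𝔼 a : Answer k n, (∑ K ∈ 𝒦, sign (parity a K)) ^ 2 := by
        simpa using expect_mul_sq_le_sq_mul_sq univ
          (fun a : Answer k n => |∑ K ∈ 𝒦, sign (parity a K)|) fun _ => 1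
    _ = ∑ K ∈ 𝒦, ∑ K' ∈ 𝒦, zeroFrac (K + K') ^ n := expect_sq_sum_sign_parity 𝒦
    _ ≤ #𝒦 • (#𝒦 * H ^ n) :=
        sum_le_card_nsmul _ _ _ fun K _ => sum_zeroFrac_add_pow_le hk h𝒦 K
    _ = (#𝒦 * H ^ ((n : ℝ) / 2)) ^ 2 := by rw [mul_pow, hpow, nsmul_eq_mul]; ring

theorem expect_abs_sum_sign_parity_le (hk : α + n ≤ k) (𝒦 : Finset (Bits k)) :
    𝔼 a : Answer k n, |∑ K ∈ 𝒦, sign (parity a K)| ≤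
      #𝒦 * hInv (1 - ((α : ℝ) + n) / k) ^ ((n : ℝ) / 2) + 2 ^ k / 2 ^ α := by
  have hH := hInv_entropyRate_nonneg hk
  rcases le_or_gt ((2 : ℝ) ^ k) (2 ^ α * #𝒦) with hlarge | hsmall
  · exact (expect_abs_sum_sign_parity_le_of_large hk hlarge).trans
      (le_add_of_nonneg_right (by positivity))
  · have hcard : (#𝒦 : ℝ) ≤ 2 ^ k / 2 ^ α := ((lt_div_iff₀' (by positivity)).2 hsmall).le
    refine (expect_le univ_nonempty fun a _ => ?_).trans (le_add_of_nonneg_left (by positivity))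
    calc |∑ K ∈ 𝒦, sign (parity a K)| ≤ ∑ K ∈ 𝒦, |sign (parity a K)| := abs_sum_le_sum_abs _ _
      _ = #𝒦 := by simp [abs_sign]
      _ ≤ _ := hcard

end NonemptyKey

theorem sum_mul_comp_le_sum_abs_fiber {ι W : Type*} [Fintype ι] [Fintype W] [DecidableEq W]
    (g : ι → W) (s : ι → ℝ) {c : W → ℝ} {B : ℝ} (hc : ∀ ω, |c ω| ≤ B) :
    ∑ x, s x * c (g x) ≤ B * ∑ ω, |∑ x with g x = ω, s x| := by
  rw [← sum_fiberwise univ g, mul_sum]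
  refine sum_le_sum fun ω _ => ?_
  calc ∑ x with g x = ω, s x * c (g x) = c ω * ∑ x with g x = ω, s x := by
        rw [mul_sum]
        exact sum_congr rfl fun x hx => by rw [(mem_filter.1 hx).2, mul_comm]
    _ ≤ |c ω| * |∑ x with g x = ω, s x| := (le_abs_self _).trans (abs_mul _ _).le
    _ ≤ B * |∑ x with g x = ω, s x| := by gcongr; exact hc ω

variable [NeZero k] {W : Type*} [Fintype W]

theorem expect_sign_parity_mul_le (hk : α + n ≤ k) (g : Bits k → W) {c : Answer k n → W → ℝ}
    (hc : ∀ a ω, |c a ω| ≤ 1 / 2) :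
    𝔼 a : Answer k n, 𝔼 K : Bits k, sign (parity a K) * c a (g K) ≤
      parityCost k α n (Fintype.card W) := by
  classical
  set H := hInv (1 - ((α : ℝ) + n) / k) ^ ((n : ℝ) / 2) with hH
  have hcard : (Fintype.card (Bits k) : ℝ) = 2 ^ k := by simp [ZMod.card]
  have hfibers : ∑ ω, (#{K | g K = ω} : ℝ) = 2 ^ k := by
    rw [← hcard, ← card_univ, card_eq_sum_card_fiberwise (f := g) (t := univ) (by simp),
      Nat.cast_sum]
  calc 𝔼 a : Answer k n, 𝔼 K : Bits k, sign (parity a K) * c a (g K)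
      ≤ 𝔼 a : Answer k n, (1 / 2 * ∑ ω, |∑ K with g K = ω, sign (parity a K)|) / 2 ^ k := by
        gcongr with a
        rw [Fintype.expect_eq_sum_div_card, hcard]
        gcongr
        exact sum_mul_comp_le_sum_abs_fiber g _ (hc a)
    _ = (1 / 2 * ∑ ω, 𝔼 a : Answer k n, |∑ K with g K = ω, sign (parity a K)|) / 2 ^ k := by
        rw [← expect_div, ← mul_expect, expect_sum_comm]
    _ ≤ (1 / 2 * ∑ ω, ((#{K | g K = ω} : ℝ) * H + 2 ^ k / 2 ^ α)) / 2 ^ k := by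
        gcongr
        exact expect_abs_sum_sign_parity_le hk _
    _ = parityCost k α n (Fintype.card W) := by
        rw [sum_add_distrib, ← sum_mul, hfibers, sum_const, card_univ, nsmul_eq_mul, parityCost,
          ← hH]
        field_simp

theorem expect_sub_eq_expect_sign (v : ZMod 2 → ℝ) (p : ZMod 2) :
    𝔼 b, (v p - v b) = 𝔼 b, sign p * (sign b * (v b - 1 / 2)) := by
  rw [Fintype.expect_eq_sum_div_card, Fintype.expect_eq_sum_div_card, sum_zmod_two, sum_zmod_two]
  rcases zmod_two_cases p with rfl | rfl <;> simp [sign_one]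

theorem expect_replace_parity_le (hk : α + n ≤ k) (g : Bits k → ZMod 2 → W)
    {u : Answer k n → W → ℝ} (hu : ∀ a ω, u a ω ∈ Set.Icc (0 : ℝ) 1) :
    𝔼 a : Answer k n, 𝔼 K : Bits k, 𝔼 b : ZMod 2, (u a (g K (parity a K)) - u a (g K b)) ≤
      parityCost k α n (Fintype.card W) := by
  simp only [fun a K => expect_sub_eq_expect_sign (fun b => u a (g K b)) (parity a K)]
  simp only [expect_comm (univ : Finset (Bits k)) (univ : Finset (ZMod 2))]
  rw [expect_comm]
  refine expect_le univ_nonempty fun b _ =>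
    expect_sign_parity_mul_le hk (g · b) (c := fun a ω => sign b * (u a ω - 1 / 2)) fun a ω => ?_
  rw [abs_mul, abs_sign, one_mul, abs_le]
  constructor <;> linarith [(hu a ω).1, (hu a ω).2]

end Parity

/-! ### Averages along random maps -/

open Classical in
/-- The real-valued indicator of a proposition; its mean is the probability of an event. -/
def ind (p : Prop) : ℝ := if p then 1 else 0

theorem ind_true {p : Prop} (hp : p) : ind p = 1 := if_pos hp

theorem ind_false {p : Prop} (hp : ¬p) : ind p = 0 := if_neg hp

theorem ind_nonneg (p : Prop) : 0 ≤ ind p := by unfold ind; positivity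

theorem ind_le {p : Prop} {c : ℝ} (hc : 0 ≤ c) (hle : p → 1 ≤ c) : ind p ≤ c := by
  by_cases hp : p
  · rw [ind_true hp]; exact hle hp
  · rwa [ind_false hp]

theorem ind_le_one (p : Prop) : ind p ≤ 1 := ind_le zero_le_one fun _ => le_rfl

theorem ind_mono {p q : Prop} (hpq : p → q) : ind p ≤ ind q :=
  ind_le (ind_nonneg q) fun hp => (ind_true (hpq hp)).ge

theorem ind_or_le (p q : Prop) : ind (p ∨ q) ≤ ind p + ind q := by
  refine ind_le (add_nonneg (ind_nonneg p) (ind_nonneg q)) ?_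
  rintro (hp | hq)
  · linarith [ind_true hp, ind_nonneg q]
  · linarith [ind_true hq, ind_nonneg p]

theorem ind_exists_mem_le {ι : Type*} (s : Finset ι) (p : ι → Prop) :
    ind (∃ i ∈ s, p i) ≤ ∑ i ∈ s, ind (p i) := by
  have hnonneg : ∀ i ∈ s, 0 ≤ ind (p i) := fun i _ => ind_nonneg _
  refine ind_le (sum_nonneg hnonneg) ?_
  rintro ⟨i, hi, hp⟩
  exact (ind_true hp).ge.trans (single_le_sum hnonneg hi)

theorem expect_ind_le_half {Ω : Type*} [Fintype Ω] [Nonempty Ω] {p : Ω → Prop}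
    (e : Equiv.Perm Ω) (he : ∀ ω, p ω → ¬p (e ω)) : 𝔼 ω, ind (p ω) ≤ 1 / 2 := by
  have hinv : 𝔼 ω, ind (p (e ω)) = 𝔼 ω, ind (p ω) := Fintype.expect_equiv e _ _ fun _ => rfl
  have hpair : 𝔼 ω, (ind (p ω) + ind (p (e ω))) ≤ 1 := by
    refine expect_le univ_nonempty fun ω _ => ?_
    by_cases hp : p ω
    · rw [ind_true hp, ind_false (he ω hp), add_zero]
    · rw [ind_false hp, zero_add]
      exact ind_le_one _
  rw [expect_add_distrib, hinv] at hpair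
  linarith

section MarkovOp

variable {Γ S : Type*} [Fintype Γ]

/-- The transition operator of the Markov chain on `S` whose step is `step γ` for uniform `γ`:
`(markovOp step ^ n) φ s` is the mean of `φ` after `n` steps from `s`. -/
def markovOp (step : Γ → S → S) : Module.End ℝ (S → ℝ) where
  toFun φ s := 𝔼 γ, φ (step γ s)
  map_add' _ _ := funext fun _ => expect_add_distrib _ _ _
  map_smul' _ _ := funext fun _ => (mul_expect _ _ _).symm

variable {step : Γ → S → S}

theorem markovOp_apply (φ : S → ℝ) (s : S) : markovOp step φ s = 𝔼 γ, φ (step γ s) := rfl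

theorem markovOp_pow_succ_apply (n : ℕ) (φ : S → ℝ) (s : S) :
    (markovOp step ^ (n + 1)) φ s = 𝔼 γ, (markovOp step ^ n) φ (step γ s) := by
  rw [pow_succ', Module.End.mul_apply, markovOp_apply]

theorem markovOp_pow_add_apply (a b : ℕ) (φ : S → ℝ) (s : S) :
    (markovOp step ^ (a + b)) φ s = (markovOp step ^ a) ((markovOp step ^ b) φ) s := by
  rw [pow_add, Module.End.mul_apply]

theorem markovOp_pow_succ_apply' (n : ℕ) (φ : S → ℝ) (s : S) :
    (markovOp step ^ (n + 1)) φ s = (markovOp step ^ n) (markovOp step φ) s := by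
  rw [pow_succ, Module.End.mul_apply]

theorem markovOp_pow_le_of_invariant {P : S → Prop} (hP : ∀ γ s, P s → P (step γ s))
    {φ ψ : S → ℝ} (hle : ∀ s, P s → φ s ≤ ψ s) (n : ℕ) {s : S} (hs : P s) :
    (markovOp step ^ n) φ s ≤ (markovOp step ^ n) ψ s := by
  induction n generalizing s with
  | zero => exact hle s hs
  | succ n ih =>
    simp only [markovOp_pow_succ_apply]
    exact expect_le_expect fun γ _ => ih (hP γ s hs)

theorem markovOp_pow_mono (n : ℕ) {φ ψ : S → ℝ} (hle : φ ≤ ψ) :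
    (markovOp step ^ n) φ ≤ (markovOp step ^ n) ψ := fun _ =>
  markovOp_pow_le_of_invariant (P := fun _ => True) (fun _ _ _ => trivial) (fun s _ => hle s) n
    trivial

theorem markovOp_pow_const [Nonempty Γ] (n : ℕ) (c : ℝ) (s : S) :
    (markovOp step ^ n) (fun _ => c) s = c := by
  induction n generalizing s with
  | zero => rfl
  | succ n ih => simp only [markovOp_pow_succ_apply, ih, Fintype.expect_const]

theorem markovOp_pow_le_const [Nonempty Γ] (n : ℕ) {φ : S → ℝ} {c : ℝ} (hle : ∀ s, φ s ≤ c)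
    (s : S) : (markovOp step ^ n) φ s ≤ c :=
  (markovOp_pow_mono n (ψ := fun _ => c) hle s).trans_eq (markovOp_pow_const n c s)

theorem markovOp_pow_expect {ι : Type*} (n : ℕ) (t : Finset ι) (φ : ι → S → ℝ) (s : S) :
    (markovOp step ^ n) (fun s => 𝔼 i ∈ t, φ i s) s = 𝔼 i ∈ t, (markovOp step ^ n) (φ i) s := by
  induction n generalizing s with
  | zero => rfl
  | succ n ih =>
    simp only [markovOp_pow_succ_apply, ih]
    exact expect_comm _ _ _

theorem markovOp_pow_comp {Γ' S' : Type*} [Fintype Γ'] {step' : Γ' → S' → S'} (π : S → S')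
    (hπ : ∀ (ψ : S' → ℝ) (s : S), 𝔼 γ, ψ (π (step γ s)) = 𝔼 γ, ψ (step' γ (π s)))
    (n : ℕ) (ψ : S' → ℝ) (s : S) :
    (markovOp step ^ n) (fun s => ψ (π s)) s = (markovOp step' ^ n) ψ (π s) := by
  induction n generalizing s with
  | zero => rfl
  | succ n ih =>
    simp only [markovOp_pow_succ_apply, ih]
    exact hπ _ s

theorem markovOp_pow_mul_le {φ : S → ℝ} {B : ℕ} {p : ℝ} (hp : 0 ≤ p)
    (hle : (markovOp step ^ B) φ ≤ p • φ) (j : ℕ) :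
    (markovOp step ^ (j * B)) φ ≤ p ^ j • φ := by
  induction j with
  | zero => simp
  | succ j ih =>
    calc (markovOp step ^ ((j + 1) * B)) φ
        = (markovOp step ^ (j * B)) ((markovOp step ^ B) φ) := by
          rw [Nat.succ_mul, pow_add, Module.End.mul_apply]
      _ ≤ (markovOp step ^ (j * B)) (p • φ) := markovOp_pow_mono _ hle
      _ = p • (markovOp step ^ (j * B)) φ := map_smul _ _ _
      _ ≤ p • p ^ j • φ := smul_le_smul_of_nonneg_left ih hp
      _ = p ^ (j + 1) • φ := by rw [smul_smul, pow_succ']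

end MarkovOp

/-! ### Thorp rounds -/

section ThorpRounds

variable {m : ℕ}

/-- The last `j` bits of `x` and `y` agree. -/
def AgreeLast (j : ℕ) (x y : Bits m) : Prop := ∀ i : Fin m, m ≤ i + j → x i = y i

theorem agreeLast_zero (x y : Bits m) : AgreeLast 0 x y := fun i hi => by omega

theorem agreeLast_self_iff {x y : Bits m} : AgreeLast m x y ↔ x = y :=
  ⟨fun hag => funext fun i => hag i (by omega), fun heq i _ => by rw [heq]⟩

theorem agreeLast_sub_one_iff {x y : Bits m} : AgreeLast (m - 1) x y ↔ right x = right y := by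
  refine ⟨fun hag => funext fun i => hag _ (by simp only; omega), fun heq i hi => ?_⟩
  have hi' : (⟨(i : ℕ) - 1 + 1, by omega⟩ : Fin m) = i := Fin.ext (by simp only; omega)
  have := congrFun heq ⟨(i : ℕ) - 1, by omega⟩
  simpa only [right, hi'] using this

theorem thorpRound_apply_of_lt (F : Bits (m - 1) → ZMod 2) (x : Bits m) {i : Fin m}
    (hi : (i : ℕ) + 1 < m) : thorpRound F x i = x ⟨i + 1, hi⟩ := dif_pos hi

variable [NeZero m]

/-- The bit `L' = L ⊕ F R` appended by a Thorp round. -/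
def newBit (F : Bits (m - 1) → ZMod 2) (x : Bits m) : ZMod 2 := x 0 + F (right x)

theorem thorpRound_apply_of_not_lt (F : Bits (m - 1) → ZMod 2) (x : Bits m) {i : Fin m}
    (hi : ¬(i : ℕ) + 1 < m) : thorpRound F x i = newBit F x := dif_neg hi

theorem eq_of_right_eq {x y : Bits m} (hright : right x = right y) (hzero : x 0 = y 0) :
    x = y := by
  funext i
  rcases eq_or_ne i 0 with rfl | hi
  · exact hzero
  · have : (i : ℕ) ≠ 0 := Fin.val_ne_zero_iff.2 hi
    exact agreeLast_sub_one_iff.2 hright i (by omega)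

theorem eq_of_newBit_eq {F : Bits (m - 1) → ZMod 2} {x y : Bits m} (hright : right x = right y)
    (hbit : newBit F x = newBit F y) : x = y := by
  rw [newBit, newBit, hright] at hbit
  exact eq_of_right_eq hright (add_right_cancel hbit)

theorem agreeLast_succ_thorpRound_iff {j : ℕ} (hj : j < m) {F F' : Bits (m - 1) → ZMod 2}
    {x y : Bits m} :
    AgreeLast (j + 1) (thorpRound F x) (thorpRound F' y) ↔
      AgreeLast j x y ∧ newBit F x = newBit F' y := by
  constructor
  · refine fun hag => ⟨fun i hi => ?_, ?_⟩
    · have hi' : (⟨(i : ℕ) - 1 + 1, by omega⟩ : Fin m) = i := Fin.ext (by simp only; omega)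
      have := hag ⟨i - 1, by omega⟩ (by simp only; omega)
      rw [thorpRound_apply_of_lt _ _ (by simp only; omega),
        thorpRound_apply_of_lt _ _ (by simp only; omega)] at this
      simpa only [hi'] using this
    · have := hag ⟨m - 1, by omega⟩ (by simp only; omega)
      rwa [thorpRound_apply_of_not_lt _ _ (by simp only; omega),
        thorpRound_apply_of_not_lt _ _ (by simp only; omega)] at this
  · rintro ⟨hag, hbit⟩ i hi
    by_cases hlt : (i : ℕ) + 1 < m
    · rw [thorpRound_apply_of_lt _ _ hlt, thorpRound_apply_of_lt _ _ hlt]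
      exact hag _ (by simp only; omega)
    · rw [thorpRound_apply_of_not_lt _ _ hlt, thorpRound_apply_of_not_lt _ _ hlt, hbit]

theorem thorpRound_eq_iff {F F' : Bits (m - 1) → ZMod 2} {x y : Bits m} :
    thorpRound F x = thorpRound F' y ↔ right x = right y ∧ newBit F x = newBit F' y := by
  have hm : 0 < m := NeZero.pos m
  rw [← agreeLast_self_iff, ← agreeLast_sub_one_iff,
    ← agreeLast_succ_thorpRound_iff (Nat.sub_lt hm one_pos),
    Nat.sub_add_cancel (Nat.one_le_of_lt hm)]

theorem thorpRound_injective (F : Bits (m - 1) → ZMod 2) : Function.Injective (thorpRound F) :=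
  fun _ _ heq => eq_of_newBit_eq (thorpRound_eq_iff.1 heq).1 (thorpRound_eq_iff.1 heq).2

/-- A Thorp round as a permutation of the cards `Bits m`. -/
def thorpPerm (F : Bits (m - 1) → ZMod 2) : Equiv.Perm (Bits m) :=
  Equiv.ofBijective (thorpRound F) (Finite.injective_iff_bijective.1 (thorpRound_injective F))

/-- The step of the Thorp shuffle: the permutation `ρ` records the position `ρ x` of every
card `x`. -/
def thorpStep (F : Bits (m - 1) → ZMod 2) (ρ : Equiv.Perm (Bits m)) : Equiv.Perm (Bits m) :=
  thorpPerm F * ρ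

theorem thorpStep_apply (F : Bits (m - 1) → ZMod 2) (ρ : Equiv.Perm (Bits m)) (x : Bits m) :
    thorpStep F ρ x = thorpRound F (ρ x) := rfl

theorem expect_newBit_eq_le {x y : Bits m} (hxy : x ≠ y) :
    𝔼 F : Bits (m - 1) → ZMod 2, ind (newBit F x = newBit F y) ≤ 1 / 2 := by
  refine expect_ind_le_half (Equiv.addRight (Pi.single (right x) 1)) fun F hF hF' => ?_
  have hright : right y ≠ right x := fun hright => hxy (eq_of_newBit_eq hright.symm hF)
  simp only [newBit, Equiv.coe_addRight, Pi.add_apply, Pi.single_eq_same,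
    Pi.single_eq_of_ne hright, add_zero, ← add_assoc] at hF hF'
  rw [hF] at hF'
  simp at hF'

theorem markovOp_thorpStep_agreeLast_le {x y : Bits m} (hxy : x ≠ y) {j : ℕ} (hj : j < m)
    (ρ : Equiv.Perm (Bits m)) :
    (markovOp thorpStep ^ j) (fun ρ => ind (AgreeLast j (ρ x) (ρ y))) ρ ≤ (1 / 2) ^ j := by
  induction j with
  | zero => exact (ind_le_one _).trans (pow_zero _).ge
  | succ j ih =>
    have hstep : markovOp thorpStep (fun ρ => ind (AgreeLast (j + 1) (ρ x) (ρ y))) ≤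
        (1 / 2 : ℝ) • fun ρ => ind (AgreeLast j (ρ x) (ρ y)) := fun ρ => by
      simp only [markovOp_apply, thorpStep_apply, Pi.smul_apply, smul_eq_mul,
        agreeLast_succ_thorpRound_iff (Nat.lt_of_succ_lt hj)]
      by_cases hag : AgreeLast j (ρ x) (ρ y)
      · simpa only [hag, true_and, ind_true, mul_one] using
          expect_newBit_eq_le (ρ.injective.ne hxy)
      · simp only [hag, false_and, ind_false not_false, expect_const_zero, mul_zero, le_refl]
    calc (markovOp thorpStep ^ (j + 1)) (fun ρ => ind (AgreeLast (j + 1) (ρ x) (ρ y))) ρ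
        ≤ (markovOp thorpStep ^ j) ((1 / 2 : ℝ) • fun ρ => ind (AgreeLast j (ρ x) (ρ y))) ρ := by
          rw [markovOp_pow_succ_apply']
          exact markovOp_pow_mono j hstep ρ
      _ = 1 / 2 * (markovOp thorpStep ^ j) (fun ρ => ind (AgreeLast j (ρ x) (ρ y))) ρ := by
          rw [map_smul, Pi.smul_apply, smul_eq_mul]
      _ ≤ 1 / 2 * (1 / 2) ^ j := by gcongr; exact ih (Nat.lt_of_succ_lt hj)
      _ = (1 / 2) ^ (j + 1) := (pow_succ' _ _).symm

theorem markovOp_thorpStep_right_eq_le {x y : Bits m} (hxy : x ≠ y) {r : ℕ} (hr : m - 1 ≤ r)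
    (ρ : Equiv.Perm (Bits m)) :
    (markovOp thorpStep ^ r) (fun ρ => ind (right (ρ x) = right (ρ y))) ρ ≤ (1 / 2) ^ (m - 1) := by
  rw [← Nat.sub_add_cancel hr, markovOp_pow_add_apply]
  refine markovOp_pow_le_const _ (fun ρ => ?_) ρ
  simpa only [agreeLast_sub_one_iff] using
    markovOp_thorpStep_agreeLast_le hxy (Nat.sub_lt (NeZero.pos m) one_pos) ρ

end ThorpRounds

/-! ### Coupling two Thorp shuffles -/

section Coupling

variable {m : ℕ}

/-- The states of two Thorp shuffles. -/
abbrev PermPair (m : ℕ) : Type := Equiv.Perm (Bits m) × Equiv.Perm (Bits m)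

/-- In one of the two shuffles the card `x` is adjacent to a card from `D`, so that the next round
moves the two cards with the same bit of the round function. -/
def Meets (D : Finset (Bits m)) (x : Bits m) (s : PermPair m) : Prop :=
  ∃ d ∈ D, right (s.1 d) = right (s.1 x) ∨ right (s.2 d) = right (s.2 x)

variable [NeZero m]

open Classical in
/-- The round function of the second shuffle when the first one uses `F`. Unless `x` meets `D`,
the values of `F` at the two positions of `x` are exchanged, and flipped if needed for `x` to
receive the same new bit in both shuffles. -/
def coupledFun (D : Finset (Bits m)) (x : Bits m) (s : PermPair m) (F : Bits (m - 1) → ZMod 2) :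
    Bits (m - 1) → ZMod 2 :=
  if Meets D x s then F
  else fun R => F (Equiv.swap (right (s.1 x)) (right (s.2 x)) R) +
    if R = right (s.1 x) ∨ R = right (s.2 x) then s.1 x 0 + s.2 x 0 else 0

/-- One round of the coupling: each shuffle is a Thorp shuffle, the cards from `D` stay together
once they are, and `x` stays together once its positions agree. -/
def coupledStep (D : Finset (Bits m)) (x : Bits m) (F : Bits (m - 1) → ZMod 2) (s : PermPair m) :
    PermPair m :=
  (thorpStep F s.1, thorpStep (coupledFun D x s F) s.2)

variable {D : Finset (Bits m)} {x : Bits m}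

theorem coupledFun_of_meets {s : PermPair m} (hs : Meets D x s) (F : Bits (m - 1) → ZMod 2) :
    coupledFun D x s F = F := if_pos hs

theorem coupledFun_of_not_meets {s : PermPair m} (hs : ¬Meets D x s)
    (F : Bits (m - 1) → ZMod 2) (R : Bits (m - 1)) :
    coupledFun D x s F R = F (Equiv.swap (right (s.1 x)) (right (s.2 x)) R) +
      if R = right (s.1 x) ∨ R = right (s.2 x) then s.1 x 0 + s.2 x 0 else 0 := by
  rw [coupledFun, if_neg hs]

theorem coupledFun_bijective (D : Finset (Bits m)) (x : Bits m) (s : PermPair m) :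
    Function.Bijective (coupledFun D x s) := by
  refine Finite.injective_iff_bijective.1 fun F F' heq => ?_
  by_cases hs : Meets D x s
  · rwa [coupledFun_of_meets hs, coupledFun_of_meets hs] at heq
  · funext R
    have := congrFun heq (Equiv.swap (right (s.1 x)) (right (s.2 x)) R)
    simpa only [coupledFun_of_not_meets hs, Equiv.swap_apply_self, add_left_inj] using this

theorem newBit_coupledFun {s : PermPair m} (hs : ¬Meets D x s) (F : Bits (m - 1) → ZMod 2) :
    newBit F (s.1 x) = newBit (coupledFun D x s F) (s.2 x) := by
  have cancel : ∀ a b c : ZMod 2, a + c = b + (c + (a + b)) := by decide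
  simp only [newBit, coupledFun_of_not_meets hs, Equiv.swap_apply_right, or_true, if_true]
  exact cancel _ _ _

theorem coupledFun_apply_of_mem {s : PermPair m} {d : Bits m} (hd : d ∈ D) (heq : s.1 d = s.2 d)
    (F : Bits (m - 1) → ZMod 2) : coupledFun D x s F (right (s.2 d)) = F (right (s.2 d)) := by
  by_cases hs : Meets D x s
  · rw [coupledFun_of_meets hs]
  · have hne₁ : right (s.2 d) ≠ right (s.1 x) := fun hr => hs ⟨d, hd, .inl (heq ▸ hr)⟩
    have hne₂ : right (s.2 d) ≠ right (s.2 x) := fun hr => hs ⟨d, hd, .inr hr⟩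
    rw [coupledFun_of_not_meets hs, Equiv.swap_apply_of_ne_of_ne hne₁ hne₂,
      if_neg (not_or.2 ⟨hne₁, hne₂⟩), add_zero]

theorem eqOn_coupledStep {s : PermPair m} (hs : Set.EqOn s.1 s.2 D) (F : Bits (m - 1) → ZMod 2) :
    Set.EqOn (coupledStep D x F s).1 (coupledStep D x F s).2 D := by
  intro d hd
  simp only [coupledStep, thorpStep_apply, hs hd, thorpRound_eq_iff, newBit, true_and]
  rw [coupledFun_apply_of_mem hd (hs hd)]

theorem coupledStep_apply_eq {s : PermPair m} (hx : s.1 x = s.2 x) (F : Bits (m - 1) → ZMod 2) :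
    (coupledStep D x F s).1 x = (coupledStep D x F s).2 x := by
  simp only [coupledStep, thorpStep_apply, thorpRound_eq_iff]
  refine ⟨by rw [hx], ?_⟩
  by_cases hs : Meets D x s
  · rw [coupledFun_of_meets hs, hx]
  · exact newBit_coupledFun hs F

theorem markovOp_coupledStep_fst (n : ℕ) (ψ : Equiv.Perm (Bits m) → ℝ) (s : PermPair m) :
    (markovOp (coupledStep D x) ^ n) (fun s => ψ s.1) s = (markovOp thorpStep ^ n) ψ s.1 :=
  markovOp_pow_comp Prod.fst (fun _ _ => rfl) n ψ s

theorem markovOp_coupledStep_snd (n : ℕ) (ψ : Equiv.Perm (Bits m) → ℝ) (s : PermPair m) :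
    (markovOp (coupledStep D x) ^ n) (fun s => ψ s.2) s = (markovOp thorpStep ^ n) ψ s.2 :=
  markovOp_pow_comp Prod.snd (fun _ s => Fintype.expect_bijective (coupledFun D x s)
    (coupledFun_bijective D x s) _ _ fun _ => rfl) n ψ s

theorem markovOp_coupledStep_not_agreeLast_le {j : ℕ} (hj : j ≤ m) (s : PermPair m) :
    (markovOp (coupledStep D x) ^ j) (fun s => ind (¬AgreeLast j (s.1 x) (s.2 x))) s ≤
      ∑ r ∈ range j, (markovOp (coupledStep D x) ^ r) (fun s => ind (Meets D x s)) s := by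
  induction j with
  | zero => simp [ind_false, agreeLast_zero]
  | succ j ih =>
    have hstep : markovOp (coupledStep D x) (fun s => ind (¬AgreeLast (j + 1) (s.1 x) (s.2 x))) ≤
        (fun s => ind (¬AgreeLast j (s.1 x) (s.2 x))) + fun s => ind (Meets D x s) := fun s =>
      expect_le univ_nonempty fun F _ => (ind_mono fun hne => ?_).trans (ind_or_le _ _)
    · rw [markovOp_pow_succ_apply', sum_range_succ]
      refine (markovOp_pow_mono j hstep s).trans ?_
      rw [map_add, Pi.add_apply]
      gcongr
      exact ih (Nat.le_of_succ_le hj)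
    · by_contra! hcon
      exact hne ((agreeLast_succ_thorpRound_iff hj).2 ⟨hcon.1, newBit_coupledFun hcon.2 F⟩)

theorem markovOp_coupledStep_meets_le (hx : x ∉ D) {r : ℕ} (hr : m - 1 ≤ r) (s : PermPair m) :
    (markovOp (coupledStep D x) ^ r) (fun s => ind (Meets D x s)) s ≤
      #D * (2 * (1 / 2) ^ (m - 1)) := by
  have hunion : (fun s => ind (Meets D x s)) ≤ ∑ d ∈ D,
      ((fun s : PermPair m => ind (right (s.1 d) = right (s.1 x))) +
        fun s : PermPair m => ind (right (s.2 d) = right (s.2 x))) := fun s => by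
    rw [Finset.sum_apply]
    exact (ind_exists_mem_le _ _).trans (sum_le_sum fun d _ => ind_or_le _ _)
  refine (markovOp_pow_mono r hunion s).trans ?_
  rw [map_sum, Finset.sum_apply, ← nsmul_eq_mul]
  refine sum_le_card_nsmul _ _ _ fun d hd => ?_
  rw [map_add, Pi.add_apply,
    markovOp_coupledStep_fst r (fun ρ => ind (right (ρ d) = right (ρ x))),
    markovOp_coupledStep_snd r (fun ρ => ind (right (ρ d) = right (ρ x))), two_mul]
  have hdx : d ≠ x := ne_of_mem_of_not_mem hd hx
  gcongr <;> exact markovOp_thorpStep_right_eq_le hdx hr _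

theorem markovOp_coupledStep_ne_block_le (hx : x ∉ D) (s : PermPair m) :
    (markovOp (coupledStep D x) ^ (2 * m - 1)) (fun s => ind (s.1 x ≠ s.2 x)) s ≤
      4 * m * #D / 2 ^ m := by
  have hm : 0 < m := NeZero.pos m
  have hsplit : 2 * m - 1 = m - 1 + m := by omega
  have hlast : (markovOp (coupledStep D x) ^ m) (fun s => ind (s.1 x ≠ s.2 x)) ≤
      ∑ r ∈ range m, (markovOp (coupledStep D x) ^ r) fun s => ind (Meets D x s) := fun s => by
    simpa only [agreeLast_self_iff, ne_eq, Finset.sum_apply] using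
      markovOp_coupledStep_not_agreeLast_le (D := D) (x := x) le_rfl s
  have hpow : m * (2 * (1 / 2 : ℝ) ^ (m - 1)) = 4 * m / 2 ^ m := by
    rw [← pow_sub_one_mul hm.ne', one_div, inv_pow]
    field_simp
    norm_num
  calc (markovOp (coupledStep D x) ^ (2 * m - 1)) (fun s => ind (s.1 x ≠ s.2 x)) s
      = (markovOp (coupledStep D x) ^ (m - 1))
          ((markovOp (coupledStep D x) ^ m) fun s => ind (s.1 x ≠ s.2 x)) s := by
        rw [hsplit, markovOp_pow_add_apply]
    _ ≤ (markovOp (coupledStep D x) ^ (m - 1))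
          (∑ r ∈ range m, (markovOp (coupledStep D x) ^ r) fun s => ind (Meets D x s)) s :=
        markovOp_pow_mono _ hlast s
    _ = ∑ r ∈ range m,
          (markovOp (coupledStep D x) ^ (m - 1 + r)) (fun s => ind (Meets D x s)) s := by
        simp only [map_sum, Finset.sum_apply, markovOp_pow_add_apply]
    _ ≤ ∑ _r ∈ range m, #D * (2 * (1 / 2 : ℝ) ^ (m - 1)) :=
        sum_le_sum fun r _ => markovOp_coupledStep_meets_le hx (Nat.le_add_right _ _) s
    _ = 4 * m * #D / 2 ^ m := by
        rw [sum_const, card_range, nsmul_eq_mul]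
        linear_combination (#D : ℝ) * hpow

theorem markovOp_coupledStep_ne_nonpos (n : ℕ) {s : PermPair m} (hs : s.1 x = s.2 x) :
    (markovOp (coupledStep D x) ^ n) (fun s => ind (s.1 x ≠ s.2 x)) s ≤ 0 :=
  (markovOp_pow_le_of_invariant (P := fun s : PermPair m => s.1 x = s.2 x) (ψ := fun _ => 0)
    (fun F _ hs => coupledStep_apply_eq hs F) (fun _ hs => (ind_false (not_not.2 hs)).le) n
    hs).trans_eq (markovOp_pow_const n 0 s)

theorem markovOp_coupledStep_ne_le (hx : x ∉ D) (j : ℕ) (s : PermPair m) :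
    (markovOp (coupledStep D x) ^ (j * (2 * m - 1))) (fun s => ind (s.1 x ≠ s.2 x)) s ≤
      (4 * m * #D / 2 ^ m) ^ j := by
  have hblock : (markovOp (coupledStep D x) ^ (2 * m - 1)) (fun s => ind (s.1 x ≠ s.2 x)) ≤
      (4 * m * #D / 2 ^ m : ℝ) • fun s => ind (s.1 x ≠ s.2 x) := fun s => by
    rw [Pi.smul_apply, smul_eq_mul]
    by_cases hs : s.1 x = s.2 x
    · rw [ind_false (not_not.2 hs), mul_zero]
      exact markovOp_coupledStep_ne_nonpos _ hs
    · rw [ind_true hs, mul_one]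
      exact markovOp_coupledStep_ne_block_le hx s
  exact (markovOp_pow_mul_le (by positivity) hblock j s).trans
    (mul_le_of_le_one_right (by positivity) (ind_le_one _))

theorem markovOp_thorpStep_sub_le (hx : x ∉ D) (j : ℕ) {v : Equiv.Perm (Bits m) → ℝ}
    (hv : ∀ ρ, v ρ ∈ Set.Icc (0 : ℝ) 1)
    (hvD : ∀ ρ ρ' : Equiv.Perm (Bits m), Set.EqOn ρ ρ' D → ρ x = ρ' x → v ρ = v ρ')
    {ρ ρ' : Equiv.Perm (Bits m)} (hD : Set.EqOn ρ ρ' D) :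
    (markovOp thorpStep ^ (j * (2 * m - 1))) v ρ - (markovOp thorpStep ^ (j * (2 * m - 1))) v ρ' ≤
      (4 * m * #D / 2 ^ m) ^ j := by
  have hdiff : ∀ s : PermPair m, Set.EqOn s.1 s.2 D → v s.1 - v s.2 ≤ ind (s.1 x ≠ s.2 x) :=
    fun s hs => by
      by_cases hsx : s.1 x = s.2 x
      · rw [hvD _ _ hs hsx, sub_self]
        exact ind_nonneg _
      · rw [ind_true hsx]
        linarith [(hv s.1).2, (hv s.2).1]
  calc (markovOp thorpStep ^ (j * (2 * m - 1))) v ρ - (markovOp thorpStep ^ (j * (2 * m - 1))) v ρ'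
      = (markovOp (coupledStep D x) ^ (j * (2 * m - 1)))
          ((fun s => v s.1) - fun s => v s.2) (ρ, ρ') := by
        rw [map_sub, Pi.sub_apply, markovOp_coupledStep_fst, markovOp_coupledStep_snd]
    _ ≤ (markovOp (coupledStep D x) ^ (j * (2 * m - 1))) (fun s => ind (s.1 x ≠ s.2 x)) (ρ, ρ') :=
        markovOp_pow_le_of_invariant (P := fun s : PermPair m => Set.EqOn s.1 s.2 D)
          (fun F _ hs => eqOn_coupledStep hs F) hdiff _ hD
    _ ≤ (4 * m * #D / 2 ^ m) ^ j := markovOp_coupledStep_ne_le hx j _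

end Coupling

/-! ### Mixing of the Thorp shuffle -/

theorem sum_range_pow_le (q s : ℕ) :
    ∑ l ∈ range q, (l : ℝ) ^ s ≤ (q : ℝ) ^ (s + 1) / (s + 1) := by
  rw [le_div_iff₀ (by positivity)]
  induction q with
  | zero => simp
  | succ q ih =>
    have bernoulli : (q : ℝ) ^ (s + 1) + (s + 1) * (q : ℝ) ^ s ≤ ((q : ℝ) + 1) ^ (s + 1) := by
      simpa using pow_add_mul_le_add_pow (b := (1 : ℝ)) q.cast_nonneg (by positivity) (s + 1)
    rw [sum_range_succ, Nat.cast_succ]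
    linarith

theorem sum_range_mul_pow_le {c : ℝ} (hc : 0 ≤ c) (q s : ℕ) :
    ∑ l ∈ range q, (c * l) ^ s ≤ (q : ℝ) / (s + 1) * (c * q) ^ s :=
  calc ∑ l ∈ range q, (c * l) ^ s
      = c ^ s * ∑ l ∈ range q, (l : ℝ) ^ s := by simp only [mul_pow, mul_sum]
    _ ≤ c ^ s * ((q : ℝ) ^ (s + 1) / (s + 1)) := by gcongr; exact sum_range_pow_le q s
    _ = (q : ℝ) / (s + 1) * (c * q) ^ s := by ring

theorem expect_subgroup_expect_mul {G : Type*} [Group G] {H N : Subgroup G} [Fintype H] [Fintype N]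
    (hNH : N ≤ H) (v : G → ℝ) : 𝔼 τ : H, 𝔼 σ : N, v (τ * σ) = 𝔼 τ : H, v τ := by
  have hshift : ∀ σ : N, 𝔼 τ : H, v (τ * σ) = 𝔼 τ : H, v τ := fun σ =>
    Fintype.expect_equiv (Equiv.mulRight ⟨σ, hNH σ.2⟩) _ _ fun _ => rfl
  rw [expect_comm]
  simp only [hshift, Fintype.expect_const]

section Mixing

variable {m : ℕ}

/-- The permutations that fix every element of `D`. -/
abbrev pointFixer (D : Finset (Bits m)) : Subgroup (Equiv.Perm (Bits m)) :=
  fixingSubgroup (Equiv.Perm (Bits m)) (D : Set (Bits m))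

theorem inv_mul_mem_pointFixer_iff {D : Finset (Bits m)} {ρ ρ' : Equiv.Perm (Bits m)} :
    ρ'⁻¹ * ρ ∈ pointFixer D ↔ Set.EqOn ρ ρ' D := by
  simp only [mem_fixingSubgroup_iff, Equiv.Perm.smul_def, Equiv.Perm.mul_apply,
    Equiv.Perm.inv_eq_iff_eq, Set.EqOn]

variable [NeZero m]

theorem markovOp_thorpStep_mul_right (n : ℕ) (v : Equiv.Perm (Bits m) → ℝ)
    (ρ σ : Equiv.Perm (Bits m)) :
    (markovOp thorpStep ^ n) v (ρ * σ) = (markovOp thorpStep ^ n) (fun ρ => v (ρ * σ)) ρ :=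
  (markovOp_pow_comp (· * σ) (fun _ _ => rfl) n v ρ).symm

theorem expect_markovOp_thorpStep (n : ℕ) (v : Equiv.Perm (Bits m) → ℝ) :
    𝔼 σ, (markovOp thorpStep ^ n) v σ = 𝔼 σ, v σ := by
  induction n with
  | zero => rfl
  | succ n ih =>
    have hshift : ∀ F : Bits (m - 1) → ZMod 2,
        𝔼 σ, (markovOp thorpStep ^ n) v (thorpStep F σ) = 𝔼 σ, v σ := fun F =>
      (Fintype.expect_equiv (Equiv.mulLeft (thorpPerm F)) _ _ fun _ => rfl).trans ih
    simp only [markovOp_pow_succ_apply]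
    rw [expect_comm]
    simp only [hshift, Fintype.expect_const]

open Classical in
theorem expect_pointFixer_insert_sub_le {D : Finset (Bits m)} {x : Bits m} (hx : x ∉ D) (j : ℕ)
    {v : Equiv.Perm (Bits m) → ℝ} (hv : ∀ ρ, v ρ ∈ Set.Icc (0 : ℝ) 1) :
    𝔼 σ : pointFixer (insert x D), (markovOp thorpStep ^ (j * (2 * m - 1))) v σ -
        𝔼 σ : pointFixer D, (markovOp thorpStep ^ (j * (2 * m - 1))) v σ ≤
      (4 * m * #D / 2 ^ m) ^ j := by
  let w : Equiv.Perm (Bits m) → ℝ := fun ρ => 𝔼 σ : pointFixer (insert x D), v (ρ * σ)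
  have hw : ∀ ρ, w ρ ∈ Set.Icc (0 : ℝ) 1 := fun ρ =>
    ⟨expect_nonneg fun σ _ => (hv _).1, expect_le univ_nonempty fun σ _ => (hv _).2⟩
  have hwD : ∀ ρ ρ' : Equiv.Perm (Bits m), Set.EqOn ρ ρ' D → ρ x = ρ' x → w ρ = w ρ' := by
    intro ρ ρ' hD hρx
    have hmem : ρ'⁻¹ * ρ ∈ pointFixer (insert x D) := by
      rw [inv_mul_mem_pointFixer_iff, coe_insert, ← Set.singleton_union, Set.eqOn_union]
      exact ⟨Set.eqOn_singleton.2 hρx, hD⟩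
    refine Fintype.expect_equiv (Equiv.mulLeft ⟨_, hmem⟩) _ _ fun σ => ?_
    simp [mul_assoc]
  have hmean : ∀ τ : Equiv.Perm (Bits m), 𝔼 σ : pointFixer (insert x D),
      (markovOp thorpStep ^ (j * (2 * m - 1))) v (τ * σ) =
        (markovOp thorpStep ^ (j * (2 * m - 1))) w τ := fun τ => by
    simp only [w, markovOp_pow_expect, markovOp_thorpStep_mul_right]
  have hmean_one := hmean 1
  simp only [one_mul] at hmean_one
  have hle : pointFixer (insert x D) ≤ pointFixer D :=
    fixingSubgroup_antitone _ _ (coe_subset.2 (subset_insert x D))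
  rw [hmean_one, ← expect_subgroup_expect_mul hle,
    ← Fintype.expect_const (ι := pointFixer D) ((markovOp thorpStep ^ (j * (2 * m - 1))) w 1),
    ← expect_sub_distrib]
  refine expect_le univ_nonempty fun τ _ => ?_
  rw [hmean]
  exact markovOp_thorpStep_sub_le hx j hw hwD
    (inv_mul_mem_pointFixer_iff.1 (by rw [mul_one]; exact inv_mem τ.2))

open Classical in
theorem expect_pointFixer_sub_expect_le (D : Finset (Bits m)) (j : ℕ)
    {v : Equiv.Perm (Bits m) → ℝ} (hv : ∀ ρ, v ρ ∈ Set.Icc (0 : ℝ) 1) :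
    𝔼 σ : pointFixer D, (markovOp thorpStep ^ (j * (2 * m - 1))) v σ - 𝔼 π, v π ≤
      ∑ l ∈ range #D, (4 * m / 2 ^ m * l : ℝ) ^ j := by
  induction D using Finset.induction_on with
  | empty =>
    have hmem : ∀ σ, σ ∈ pointFixer (∅ : Finset (Bits m)) := fun σ => by
      rw [pointFixer, coe_empty, fixingSubgroup_empty]
      exact Subgroup.mem_top σ
    have hall : 𝔼 σ : pointFixer ∅, (markovOp thorpStep ^ (j * (2 * m - 1))) v σ =
        𝔼 σ, (markovOp thorpStep ^ (j * (2 * m - 1))) v σ :=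
      Fintype.expect_equiv (Equiv.subtypeUnivEquiv hmem) _ _ fun _ => rfl
    rw [hall, expect_markovOp_thorpStep, sub_self, card_empty, sum_range_zero]
  | insert x D hx ih =>
    have hstep := expect_pointFixer_insert_sub_le hx j hv
    rw [← div_mul_eq_mul_div] at hstep
    rw [card_insert_of_notMem hx, sum_range_succ]
    linarith

theorem markovOp_thorpStep_sub_expect_le {q : ℕ} (M : Fin q ↪ Bits m) (s : ℕ)
    {v : Equiv.Perm (Bits m) → ℝ} (hv : ∀ ρ, v ρ ∈ Set.Icc (0 : ℝ) 1)
    (hvM : ∀ ρ ρ' : Equiv.Perm (Bits m), (∀ i, ρ (M i) = ρ' (M i)) → v ρ = v ρ') :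
    (markovOp thorpStep ^ (s * (2 * m - 1))) v 1 - 𝔼 π, v π ≤
      (q : ℝ) / (s + 1) * (4 * m * q / 2 ^ m) ^ s := by
  classical
  have hconst : ∀ σ : pointFixer (univ.map M), (markovOp thorpStep ^ (s * (2 * m - 1))) v σ =
      (markovOp thorpStep ^ (s * (2 * m - 1))) v 1 := fun σ => by
    have hfix : (fun ρ : Equiv.Perm (Bits m) => v (ρ * σ)) = v := funext fun ρ => hvM _ _ fun i =>
      congrArg ρ ((mem_fixingSubgroup_iff _).1 σ.2 (M i) (by simp))
    rw [← one_mul (σ : Equiv.Perm (Bits m)), markovOp_thorpStep_mul_right, hfix]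
  have hmix := expect_pointFixer_sub_expect_le (univ.map M) s hv
  simp only [hconst, Fintype.expect_const, card_map, card_univ, Fintype.card_fin] at hmix
  rw [← div_mul_eq_mul_div]
  exact hmix.trans (sum_range_mul_pow_le (by positivity) q s)

end Mixing

/-! ### Trajectories of messages -/

section Trajectories

variable {m T : ℕ}

/-- The composition of `T` Thorp rounds with the given round functions. -/
def thorpCipher (f : Query m T → ZMod 2) (x : Bits m) : Bits m :=
  Fin.foldl T (fun y r => thorpRound (fun R => f (R, r)) y) x

theorem cipher_eq_thorpCipher {k n : ℕ} (O : Oracle k m n T) (K : Bits k) :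
    cipher O K = thorpCipher fun a => parity (O a) K := rfl

/-- The position of the message `x` after the first `r` rounds; it stays constant for `r ≥ T`. -/
def traj (f : Query m T → ZMod 2) (x : Bits m) : ℕ → Bits m
  | 0 => x
  | r + 1 => if hr : r < T then thorpRound (fun R => f (R, ⟨r, hr⟩)) (traj f x r) else traj f x r

theorem traj_succ (f : Query m T → ZMod 2) (x : Bits m) (r : Fin T) :
    traj f x (r + 1) = thorpRound (fun R => f (R, r)) (traj f x r) := dif_pos r.2

/-- The point at which round `r` evaluates the round function for the message `x`. -/
def visit (f : Query m T → ZMod 2) (x : Bits m) (r : Fin T) : Query m T :=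
  (right (traj f x r), r)

theorem foldl_eq_of_forall_succ {β : Type*} {T : ℕ} {g : Fin T → β → β} {y : ℕ → β}
    (hy : ∀ r : Fin T, y (r + 1) = g r (y r)) : Fin.foldl T (fun z r => g r z) (y 0) = y T := by
  induction T with
  | zero => rw [Fin.foldl_zero]
  | succ T ih =>
    rw [Fin.foldl_succ_last, ih (g := fun r => g r.castSucc) fun r => hy r.castSucc]
    exact (hy (Fin.last T)).symm

theorem thorpCipher_eq_traj (f : Query m T → ZMod 2) (x : Bits m) :
    thorpCipher f x = traj f x T := foldl_eq_of_forall_succ (traj_succ f x)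

variable [NeZero m]

theorem traj_congr {f g : Query m T → ZMod 2} {x : Bits m} {r : ℕ} (hr : r ≤ T)
    (heq : ∀ t : Fin T, (t : ℕ) < r → f (visit f x t) = g (visit f x t)) :
    traj f x r = traj g x r := by
  induction r with
  | zero => rfl
  | succ r ih =>
    have ih' := ih (Nat.le_of_succ_le hr) fun t ht => heq t (Nat.lt_succ_of_lt ht)
    have hlast := heq ⟨r, hr⟩ r.lt_succ_self
    rw [traj_succ f x ⟨r, hr⟩, traj_succ g x ⟨r, hr⟩, ← ih', thorpRound_eq_iff]
    exact ⟨rfl, congrArg (traj f x r 0 + ·) hlast⟩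

theorem traj_bijective (f : Query m T → ZMod 2) (r : ℕ) :
    Function.Bijective fun x => traj f x r := by
  refine Finite.injective_iff_bijective.1 ?_
  induction r with
  | zero => exact fun x y heq => heq
  | succ r ih =>
    by_cases hr : r < T
    · simp only [traj, hr, dite_true]
      exact (thorpRound_injective _).comp ih
    · simpa only [traj, hr, dite_false] using ih

/-- Splitting off the first round of a family of round functions. -/
def roundFunConsEquiv (m T : ℕ) :
    (Query m (T + 1) → ZMod 2) ≃ (Bits (m - 1) → ZMod 2) × (Query m T → ZMod 2) where
  toFun f := (fun R => f (R, 0), fun a => f (a.1, a.2.succ))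
  invFun p a := Fin.cases (p.1 a.1) (fun r => p.2 (a.1, r)) a.2
  left_inv f := by
    funext ⟨R, r⟩
    cases r using Fin.cases <;> rfl
  right_inv p := rfl

theorem expect_thorpCipher_eq_markovOp (φ : (Bits m → Bits m) → ℝ) (ρ : Equiv.Perm (Bits m)) :
    𝔼 f : Query m T → ZMod 2, φ (thorpCipher f ∘ ρ) =
      (markovOp thorpStep ^ T) (fun ρ => φ ρ) ρ := by
  induction T generalizing ρ with
  | zero =>
    have hid : ∀ f : Query m 0 → ZMod 2, thorpCipher f ∘ ρ = ρ := fun f =>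
      funext fun x => by rw [Function.comp_apply, thorpCipher, Fin.foldl_zero]
    simp only [hid, Fintype.expect_const, pow_zero, Module.End.one_apply]
  | succ T ih =>
    simp only [markovOp_pow_succ_apply, ← ih]
    rw [← expect_product']
    refine Fintype.expect_equiv (roundFunConsEquiv m T) _ _ fun f => congrArg φ ?_
    funext x
    simp only [Function.comp_apply, thorpCipher, Fin.foldl_succ]
    rfl

end Trajectories

/-! ### Random messages -/

theorem expect_perm_apply {β : Type*} [Fintype β] [DecidableEq β] (φ : β → ℝ) (y : β) :
    𝔼 π : Equiv.Perm β, φ (π y) = 𝔼 x, φ x := by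
  have hswap : ∀ z, 𝔼 π : Equiv.Perm β, φ (π z) = 𝔼 π : Equiv.Perm β, φ (π y) := fun z =>
    Fintype.expect_equiv (Equiv.mulRight (Equiv.swap y z)) _ _ fun π => by simp
  have : Nonempty β := ⟨y⟩
  calc 𝔼 π : Equiv.Perm β, φ (π y)
      = 𝔼 z, 𝔼 π : Equiv.Perm β, φ (π z) := by simp only [hswap, Fintype.expect_const]
    _ = 𝔼 π : Equiv.Perm β, 𝔼 z, φ (π z) := expect_comm _ _ _
    _ = 𝔼 x, φ x := by
      simp only [fun π : Equiv.Perm β => Fintype.expect_equiv π (fun z => φ (π z)) φ fun _ => rfl,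
        Fintype.expect_const]

theorem expect_embedding_apply {ι β : Type*} [Fintype β] [Fintype (ι ↪ β)]
    [Nonempty (ι ↪ β)] (i : ι) (φ : β → ℝ) : 𝔼 M : ι ↪ β, φ (M i) = 𝔼 x, φ x := by
  classical
  have hperm : ∀ π : Equiv.Perm β, 𝔼 M : ι ↪ β, φ (π (M i)) = 𝔼 M : ι ↪ β, φ (M i) := fun π =>
    Fintype.expect_equiv (Equiv.embeddingCongr (Equiv.refl ι) π) _ _ fun _ => rfl
  calc 𝔼 M : ι ↪ β, φ (M i)
      = 𝔼 π : Equiv.Perm β, 𝔼 M : ι ↪ β, φ (π (M i)) := by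
        simp only [hperm, Fintype.expect_const]
    _ = 𝔼 M : ι ↪ β, 𝔼 π : Equiv.Perm β, φ (π (M i)) := expect_comm _ _ _
    _ = 𝔼 x, φ x := by simp only [expect_perm_apply, Fintype.expect_const]

section Visits

variable {m : ℕ} [NeZero m]

theorem expect_ind_right_eq_le (R : Bits (m - 1)) :
    𝔼 y : Bits m, ind (right y = R) ≤ 1 / 2 ^ (m - 1) := by
  have hsum : ∑ y : Bits m, ind (right y = R) = #{y : Bits m | right y = R} := by
    rw [natCast_card_filter]
    exact sum_congr rfl fun y _ => by unfold ind; congr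
  have hfiber : #{y : Bits m | right y = R} ≤ 2 :=
    card_le_card_of_injOn (t := (univ : Finset (ZMod 2))) (fun y => y 0) (fun _ _ => by simp)
      fun y hy y' hy' heq => eq_of_right_eq (by simp_all) heq
  have hcard : (Fintype.card (Bits m) : ℝ) = 2 * 2 ^ (m - 1) := by
    rw [mul_pow_sub_one (NeZero.ne m)]
    simp [ZMod.card]
  calc 𝔼 y : Bits m, ind (right y = R)
      = #{y : Bits m | right y = R} / (2 * 2 ^ (m - 1)) := by
        rw [Fintype.expect_eq_sum_div_card, hcard, hsum]
    _ ≤ 2 / (2 * 2 ^ (m - 1)) := by gcongr; exact_mod_cast hfiber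
    _ = 1 / 2 ^ (m - 1) := by field_simp

theorem expect_visit_mem_le {T : ℕ} (S : Finset (Query m T)) (f : Query m T → ZMod 2)
    (r : Fin T) : 𝔼 x, ind (visit f x r ∈ S) ≤ #{a ∈ S | a.2 = r} / 2 ^ (m - 1) := by
  have hunion : ∀ y : Bits m, ind ((right y, r) ∈ S) ≤ ∑ a ∈ S with a.2 = r, ind (right y = a.1) :=
    fun y => (ind_mono fun hy => ⟨_, mem_filter.2 ⟨hy, rfl⟩, rfl⟩).trans (ind_exists_mem_le _ _)
  calc 𝔼 x, ind (visit f x r ∈ S)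
      = 𝔼 y : Bits m, ind ((right y, r) ∈ S) :=
        Fintype.expect_bijective _ (traj_bijective f r) _ _ fun _ => rfl
    _ ≤ 𝔼 y : Bits m, ∑ a ∈ S with a.2 = r, ind (right y = a.1) :=
        expect_le_expect fun y _ => hunion y
    _ ≤ #{a ∈ S | a.2 = r} • (1 / 2 ^ (m - 1) : ℝ) := by
        rw [expect_sum_comm]
        exact sum_le_card_nsmul _ _ _ fun a _ => expect_ind_right_eq_le a.1
    _ = #{a ∈ S | a.2 = r} / 2 ^ (m - 1) := by rw [nsmul_eq_mul, mul_one_div]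

theorem sum_expect_visit_mem_le {q T : ℕ} [Nonempty (Fin q ↪ Bits m)] (S : Finset (Query m T))
    (f : Query m T → ZMod 2) :
    ∑ i : Fin q, ∑ r : Fin T, 𝔼 M : Fin q ↪ Bits m, ind (visit f (M i) r ∈ S) ≤
      q * #S / 2 ^ (m - 1) :=
  calc ∑ i : Fin q, ∑ r : Fin T, 𝔼 M : Fin q ↪ Bits m, ind (visit f (M i) r ∈ S)
      = ∑ _i : Fin q, ∑ r : Fin T, 𝔼 x, ind (visit f x r ∈ S) := by
        simp only [fun r i => expect_embedding_apply (ι := Fin q) i fun x => ind (visit f x r ∈ S)]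
    _ ≤ ∑ _i : Fin q, ∑ r : Fin T, (#{a ∈ S | a.2 = r} : ℝ) / 2 ^ (m - 1) := by
        gcongr; exact expect_visit_mem_le S f _
    _ = q * #S / 2 ^ (m - 1) := by
        rw [← sum_div, ← Nat.cast_sum, ← card_eq_sum_card_fiberwise fun _ _ => by simp]
        simp [mul_div_assoc]

end Visits

/-! ### Queries of an algorithm -/

section Queries

variable {I A β : Type} [DecidableEq I]

/-- The set of points at which an algorithm queries the oracle. -/
def OracleAlg.queried (O : I → A) : {Q : ℕ} → OracleAlg I A β Q → Finset I
  | _, .ret _ => ∅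
  | _, .ask x next => insert x ((next (O x)).queried O)

theorem OracleAlg.card_queried_le (O : I → A) {Q : ℕ} (𝒜 : OracleAlg I A β Q) :
    #(𝒜.queried O) ≤ Q := by
  induction 𝒜 with
  | ret _ => exact Nat.zero_le _
  | ask x next ih => exact (card_insert_le _ _).trans (Nat.succ_le_succ (ih _))

theorem OracleAlg.run_congr {O O' : I → A} {Q : ℕ} (𝒜 : OracleAlg I A β Q)
    (heq : ∀ x ∈ 𝒜.queried O, O x = O' x) : 𝒜.run O = 𝒜.run O' := by
  induction 𝒜 with
  | ret b => rfl
  | ask x next ih =>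
    rw [run, run, ← heq x (mem_insert_self _ _)]
    exact ih _ fun y hy => heq y (mem_insert_of_mem hy)

theorem OracleAlg.run_update {O : I → A} {Q : ℕ} (𝒜 : OracleAlg I A β Q) {x : I}
    (hx : x ∉ 𝒜.queried O) (a : A) : 𝒜.run (Function.update O x a) = 𝒜.run O :=
  (𝒜.run_congr fun _ hy =>
    (Function.update_of_ne (ne_of_mem_of_not_mem hy hx) _ _).symm).symm

end Queries

/-! ### Exposing a table point by point along an adaptive exploration -/

section Resampling

variable {I A : Type*} [Fintype I] [DecidableEq I] [Fintype A]

theorem expect_resample [Nonempty A] {P : (I → A) → Prop} [DecidablePred P] {p : (I → A) → I}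
    (hP : ∀ f a, P f → P (Function.update f (p f) a))
    (hp : ∀ f a, P f → p (Function.update f (p f) a) = p f) (ψ : (I → A) → ℝ) :
    𝔼 f, 𝔼 a, ψ (if P f then Function.update f (p f) a else f) = 𝔼 f, ψ f := by
  let swapValue : (I → A) × A → (I → A) × A := fun z =>
    if P z.1 then (Function.update z.1 (p z.1) z.2, z.1 (p z.1)) else z
  have hinv : Function.Involutive swapValue := by
    rintro ⟨f, a⟩
    by_cases hf : P f
    · simp [swapValue, hf, hP f a hf, hp f a hf]
    · simp [swapValue, hf]
  calc 𝔼 f, 𝔼 a, ψ (if P f then Function.update f (p f) a else f)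
      = 𝔼 z : (I → A) × A, ψ (if P z.1 then Function.update z.1 (p z.1) z.2 else z.1) :=
        (expect_product' _ _ _).symm
    _ = 𝔼 z : (I → A) × A, ψ z.1 :=
        Fintype.expect_equiv hinv.toPerm _ _ fun z => congrArg ψ (by
          by_cases hz : P z.1 <;> simp [swapValue, hz])
    _ = 𝔼 f, 𝔼 _a : A, ψ f := expect_product' univ univ fun f (_ : A) => ψ f
    _ = 𝔼 f, ψ f := by simp only [Fintype.expect_const]

theorem expect_update [Nonempty A] (x : I) (ψ : (I → A) → ℝ) :
    𝔼 f, 𝔼 a, ψ (Function.update f x a) = 𝔼 f, ψ f := by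
  simpa only [if_true] using
    expect_resample (P := fun _ => True) (p := fun _ => x) (fun _ _ h => h) (fun _ _ _ => rfl) ψ

end Resampling

section Exploration

variable {I A : Type*} {N : ℕ}

/-- The exploration of a table whose `t`-th point on the table `f` is `pt t f` is adapted if each
point is determined by the values at the earlier points. -/
def Adapted (pt : Fin N → (I → A) → I) : Prop :=
  ∀ (t : Fin N) (f g : I → A), (∀ u < t, f (pt u f) = g (pt u f)) → pt t f = pt t g

variable [DecidableEq I]

/-- The set of the first `t` points of an exploration. -/
def visited (pt : Fin N → (I → A) → I) (t : ℕ) (f : I → A) : Finset I :=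
  ({u : Fin N | (u : ℕ) < t} : Finset (Fin N)).image (pt · f)

theorem mem_visited {pt : Fin N → (I → A) → I} {t : ℕ} {f : I → A} {x : I} :
    x ∈ visited pt t f ↔ ∃ u : Fin N, (u : ℕ) < t ∧ pt u f = x := by
  simp only [visited, mem_image, mem_filter_univ]

theorem visited_zero (pt : Fin N → (I → A) → I) (f : I → A) : visited pt 0 f = ∅ := by
  simp [visited]

theorem visited_succ (pt : Fin N → (I → A) → I) (t : Fin N) (f : I → A) :
    visited pt (t + 1) f = insert (pt t f) (visited pt t f) := by
  have hle : ({u : Fin N | (u : ℕ) < t + 1} : Finset (Fin N)) =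
      insert t ({u : Fin N | (u : ℕ) < t} : Finset (Fin N)) := by
    ext u
    simp only [mem_filter_univ, mem_insert, Fin.ext_iff]
    omega
  rw [visited, hle, image_insert, visited]

variable {pt : Fin N → (I → A) → I}

theorem Adapted.update_of_le (hpt : Adapted pt) {t u : Fin N} {f : I → A}
    (hnew : pt t f ∉ visited pt t f) (a : A) (hu : u ≤ t) :
    pt u (Function.update f (pt t f) a) = pt u f := by
  refine (hpt u f _ fun v hv => ?_).symm
  rw [Function.update_of_ne]
  exact fun heq => hnew (mem_visited.2 ⟨v, hv.trans_le hu, heq⟩)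

theorem Adapted.visited_update (hpt : Adapted pt) {t : Fin N} {f : I → A}
    (hnew : pt t f ∉ visited pt t f) (a : A) :
    visited pt t (Function.update f (pt t f) a) = visited pt t f :=
  image_congr fun _ hu => hpt.update_of_le hnew a (mem_filter.1 hu).2.le

variable [Fintype I] [Fintype A] [Nonempty A] {Θ : Finset I → (I → A) → ℝ} {c : I → ℝ}

theorem Adapted.expect_visited_sub_succ_le (hpt : Adapted pt)
    (hΘ : ∀ V : Finset I, DependsOn (Θ V) V) (hc : ∀ x, 0 ≤ c x)
    (hcost : ∀ V f x, x ∉ V → 𝔼 a, (Θ V f - Θ (insert x V) (Function.update f x a)) ≤ c x)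
    (t : Fin N) :
    𝔼 f, Θ (visited pt t f) f - 𝔼 f, Θ (visited pt (t + 1) f) f ≤ 𝔼 f, c (pt t f) := by
  rw [← expect_sub_distrib, ← expect_resample (P := fun f => pt t f ∉ visited pt t f) (p := pt t)
    (fun f a hf => by rwa [hpt.visited_update hf, hpt.update_of_le hf a le_rfl])
    fun f a hf => hpt.update_of_le hf a le_rfl]
  refine expect_le_expect fun f _ => ?_
  by_cases hnew : pt t f ∉ visited pt t f
  · have hold : ∀ a, Θ (visited pt t f) (Function.update f (pt t f) a) = Θ (visited pt t f) f :=
      fun a => hΘ _ fun x hx => Function.update_of_ne (ne_of_mem_of_not_mem hx hnew) _ _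
    simp only [if_pos hnew, visited_succ, hpt.visited_update hnew,
      hpt.update_of_le hnew _ le_rfl, hold]
    exact hcost _ f _ hnew
  · simp only [if_neg hnew, visited_succ, insert_eq_of_mem (not_not.1 hnew), sub_self,
      Fintype.expect_const, hc]

theorem Adapted.expect_empty_sub_visited_le (hpt : Adapted pt)
    (hΘ : ∀ V : Finset I, DependsOn (Θ V) V) (hc : ∀ x, 0 ≤ c x)
    (hcost : ∀ V f x, x ∉ V → 𝔼 a, (Θ V f - Θ (insert x V) (Function.update f x a)) ≤ c x) :
    𝔼 f, Θ ∅ f - 𝔼 f, Θ (visited pt N f) f ≤ ∑ t, 𝔼 f, c (pt t f) := by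
  let G : ℕ → ℝ := fun t => 𝔼 f, Θ (visited pt t f) f
  calc 𝔼 f, Θ ∅ f - 𝔼 f, Θ (visited pt N f) f
      = G 0 - G N := by simp only [G, visited_zero]
    _ = ∑ t : Fin N, (G t - G (t + 1)) := by
        rw [← sum_range_sub' G, Fin.sum_univ_eq_sum_range fun t => G t - G (t + 1)]
    _ ≤ ∑ t, 𝔼 f, c (pt t f) :=
        sum_le_sum fun t _ => hpt.expect_visited_sub_succ_le hΘ hc hcost t

end Exploration

/-! ### Replacing the pseudorandom function by random round functions -/

section MessageExploration

variable {m q T : ℕ}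

/-- The exploration of the table of round functions by the encryption of the messages, message by
message. -/
def explore (M : Fin q → Bits m) (t : Fin (q * T)) (f : Query m T → ZMod 2) : Query m T :=
  visit f (M (finProdFinEquiv.symm t).1) (finProdFinEquiv.symm t).2

theorem explore_finProdFinEquiv (M : Fin q → Bits m) (i : Fin q) (r : Fin T)
    (f : Query m T → ZMod 2) : explore M (finProdFinEquiv (i, r)) f = visit f (M i) r := by
  rw [explore, Equiv.symm_apply_apply]

theorem sum_explore (M : Fin q → Bits m) (f : Query m T → ZMod 2) (φ : Query m T → ℝ) :
    ∑ t, φ (explore M t f) = ∑ i, ∑ r, φ (visit f (M i) r) := by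
  rw [← Fintype.sum_prod_type']
  exact (Fintype.sum_equiv finProdFinEquiv _ _ fun p => by rw [explore_finProdFinEquiv]).symm

variable [NeZero m]

theorem adapted_explore (M : Fin q → Bits m) : Adapted (explore (T := T) M) := by
  intro t f g heq
  obtain ⟨⟨i, r⟩, rfl⟩ := finProdFinEquiv.surjective t
  rw [explore_finProdFinEquiv, explore_finProdFinEquiv, visit, visit, traj_congr r.2.le]
  intro r' hr'
  have hlt : finProdFinEquiv (i, r') < finProdFinEquiv (i, r) := by
    rw [Fin.lt_def, finProdFinEquiv_apply_val, finProdFinEquiv_apply_val]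
    exact Nat.add_lt_add_right hr' _
  simpa only [explore_finProdFinEquiv] using heq _ hlt

theorem thorpCipher_piecewise_visited (M : Fin q → Bits m) (f g : Query m T → ZMod 2)
    (i : Fin q) :
    thorpCipher ((visited (explore M) (q * T) f).piecewise f g) (M i) = thorpCipher f (M i) := by
  rw [thorpCipher_eq_traj, thorpCipher_eq_traj]
  refine (traj_congr le_rfl fun r _ => ?_).symm
  rw [piecewise_eq_of_mem]
  exact mem_visited.2 ⟨finProdFinEquiv (i, r), Fin.is_lt _, explore_finProdFinEquiv M i r f⟩

end MessageExploration

theorem piecewise_insert_update {I A : Type*} [DecidableEq I] (V : Finset I) (f g : I → A) (x : I)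
    (a : A) :
    (insert x V).piecewise (Function.update f x a) g = Function.update (V.piecewise f g) x a := by
  funext y
  by_cases hy : y = x
  · rw [hy, piecewise_insert_self, Function.update_self, Function.update_self]
  · by_cases hV : y ∈ V <;> simp [hy, hV]

section Hybrid

variable {k m n ℓ q Q T : ℕ}

/-- The indicator that a deterministic adversary guesses world 1 when it is given the
ciphertexts `C` of the messages `M`. -/
def accept (A : DetAdversary k m n ℓ q Q T) (O : Oracle k m n T) (K : Bits k)
    (M C : Fin q → Bits m) : ℝ :=
  ind ((A.run O).2 { leakage := (A.run O).1 K, pairs := fun i => (M i, C i), oracle := O } = true)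

theorem accept_mem_Icc (A : DetAdversary k m n ℓ q Q T) (O : Oracle k m n T) (K : Bits k)
    (M C : Fin q → Bits m) : accept A O K M C ∈ Set.Icc (0 : ℝ) 1 :=
  ⟨ind_nonneg _, ind_le_one _⟩

/-- The probability that a deterministic adversary guesses world 1 on the messages `M` when the
round functions are given by the table `f` on `V` and by the big-key pseudorandom function
elsewhere. -/
def hybridProb (A : DetAdversary k m n ℓ q Q T) (M : Fin q → Bits m) (V : Finset (Query m T))
    (f : Query m T → ZMod 2) : ℝ :=
  𝔼 O : Oracle k m n T, 𝔼 K : Bits k,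
    accept A O K M fun i => thorpCipher (V.piecewise f fun x => parity (O x) K) (M i)

theorem dependsOn_hybridProb (A : DetAdversary k m n ℓ q Q T) (M : Fin q → Bits m)
    (V : Finset (Query m T)) : DependsOn (hybridProb A M V) V := by
  intro f g heq
  simp only [hybridProb, V.piecewise_congr heq fun _ _ => rfl]

theorem hybridProb_empty (A : DetAdversary k m n ℓ q Q T) (M : Fin q → Bits m)
    (f : Query m T → ZMod 2) :
    hybridProb A M ∅ f =
      𝔼 O : Oracle k m n T, 𝔼 K : Bits k, accept A O K M fun i => cipher O K (M i) := by
  simp only [hybridProb, piecewise_empty, cipher_eq_thorpCipher]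

theorem hybridProb_visited [NeZero m] (A : DetAdversary k m n ℓ q Q T) (M : Fin q → Bits m)
    (f : Query m T → ZMod 2) :
    hybridProb A M (visited (explore M) (q * T) f) f =
      𝔼 O : Oracle k m n T, 𝔼 K : Bits k, accept A O K M fun i => thorpCipher f (M i) := by
  simp only [hybridProb, thorpCipher_piecewise_visited]

theorem parity_update (O : Oracle k m n T) (x : Query m T) (a : Answer k n) (K : Bits k) :
    (fun y => parity (Function.update O x a y) K) =
      Function.update (fun y => parity (O y) K) x (parity a K) :=
  funext fun y => Function.apply_update (fun _ a => parity a K) O x a y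

theorem piecewise_parity_update {V : Finset (Query m T)} {x : Query m T} (hx : x ∉ V)
    (f : Query m T → ZMod 2) (O : Oracle k m n T) (a : Answer k n) (K : Bits k) :
    (V.piecewise f fun y => parity (Function.update O x a y) K) =
      Function.update (V.piecewise f fun y => parity (O y) K) x (parity a K) := by
  rw [parity_update, update_piecewise_of_notMem _ _ _ hx]

variable [NeZero k] {α : ℕ}

theorem expect_accept_replace_parity_le_of_notMem (hk : α + n ≤ k)
    (A : DetAdversary k m n ℓ q Q T) {O : Oracle k m n T} {x : Query m T}
    (hx : x ∉ A.queried O) (M : Fin q → Bits m) (C : Bits k → ZMod 2 → Fin q → Bits m) :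
    𝔼 a, 𝔼 K, 𝔼 b, (accept A (Function.update O x a) K M (C K (parity a K)) -
      accept A (Function.update O x a) K M (C K b)) ≤ parityCost k α n (2 ^ (ℓ + m * q)) := by
  have hcard : Fintype.card (Bits ℓ × (Fin q → Bits m)) = 2 ^ (ℓ + m * q) := by
    simp [ZMod.card, pow_add, pow_mul]
  simp only [accept, A.run_update hx, ← hcard]
  exact expect_replace_parity_le hk (fun K b => ((A.run O).1 K, C K b))
    (u := fun a ω => ind ((A.run O).2
      { leakage := ω.1, pairs := fun i => (M i, ω.2 i), oracle := Function.update O x a } = true))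
    fun _ _ => ⟨ind_nonneg _, ind_le_one _⟩

theorem expect_accept_replace_parity_le (hk : α + n ≤ k) (A : DetAdversary k m n ℓ q Q T)
    (O : Oracle k m n T) (x : Query m T) (M : Fin q → Bits m)
    (C : Bits k → ZMod 2 → Fin q → Bits m) :
    𝔼 a, 𝔼 K, 𝔼 b, (accept A (Function.update O x a) K M (C K (parity a K)) -
      accept A (Function.update O x a) K M (C K b)) ≤
        parityCost k α n (2 ^ (ℓ + m * q)) + ind (x ∈ A.queried O) := by
  by_cases hx : x ∈ A.queried O
  · rw [ind_true hx]
    refine le_trans ?_ (le_add_of_nonneg_left (parityCost_nonneg hk _))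
    refine expect_le univ_nonempty fun a _ => expect_le univ_nonempty fun K _ =>
      expect_le univ_nonempty fun b _ => ?_
    exact (sub_le_self _ (accept_mem_Icc ..).1).trans (accept_mem_Icc ..).2
  · rw [ind_false hx, add_zero]
    exact expect_accept_replace_parity_le_of_notMem hk A hx M C

theorem expect_hybridProb_sub_insert_le (hk : α + n ≤ k) (A : DetAdversary k m n ℓ q Q T)
    (M : Fin q → Bits m) (V : Finset (Query m T)) (f : Query m T → ZMod 2) {x : Query m T}
    (hx : x ∉ V) :
    𝔼 b, (hybridProb A M V f - hybridProb A M (insert x V) (Function.update f x b)) ≤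
      parityCost k α n (2 ^ (ℓ + m * q)) + 𝔼 O : Oracle k m n T, ind (x ∈ A.queried O) := by
  let C : Oracle k m n T → Bits k → ZMod 2 → Fin q → Bits m := fun O K b i =>
    thorpCipher (Function.update (V.piecewise f fun y => parity (O y) K) x b) (M i)
  calc 𝔼 b, (hybridProb A M V f - hybridProb A M (insert x V) (Function.update f x b))
      = 𝔼 O, 𝔼 K, 𝔼 b, ((accept A O K M fun i =>
          thorpCipher (V.piecewise f fun y => parity (O y) K) (M i)) -
            accept A O K M (C O K b)) := by
        simp only [hybridProb, piecewise_insert_update, ← expect_sub_distrib, C]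
        rw [expect_comm]
        exact expect_congr rfl fun O _ => expect_comm _ _ _
    _ = 𝔼 O : Oracle k m n T, 𝔼 a, 𝔼 K, 𝔼 b,
          (accept A (Function.update O x a) K M (C O K (parity a K)) -
            accept A (Function.update O x a) K M (C O K b)) := by
        rw [← expect_update x]
        simp only [C, piecewise_parity_update hx, Function.update_idem]
    _ ≤ 𝔼 O, (parityCost k α n (2 ^ (ℓ + m * q)) + ind (x ∈ A.queried O)) :=
        expect_le_expect fun O _ => expect_accept_replace_parity_le hk A O x M (C O)
    _ = parityCost k α n (2 ^ (ℓ + m * q)) + 𝔼 O : Oracle k m n T, ind (x ∈ A.queried O) := by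
        rw [expect_add_distrib, Fintype.expect_const]

end Hybrid

/-! ### The advantage of a deterministic adversary -/

theorem expect_rotate {ι κ τ : Type*} [Fintype ι] [Fintype κ] [Fintype τ] (φ : ι → κ → τ → ℝ) :
    𝔼 a, 𝔼 b, 𝔼 c, φ a b c = 𝔼 c, 𝔼 a, 𝔼 b, φ a b c := by
  rw [expect_comm univ univ fun c a => 𝔼 b, φ a b c]
  exact expect_congr rfl fun a _ => expect_comm _ _ _

section Advantage

variable {k m n ℓ q Q T : ℕ} [NeZero m]

theorem expect_cipher_sub_expect_thorpCipher_le_visits [NeZero k] {α : ℕ} (hk : α + n ≤ k)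
    (A : DetAdversary k m n ℓ q Q T) (M : Fin q → Bits m) :
    𝔼 O : Oracle k m n T, 𝔼 K : Bits k, accept A O K M (fun i => cipher O K (M i)) -
      𝔼 f : Query m T → ZMod 2, 𝔼 O : Oracle k m n T, 𝔼 K : Bits k,
        accept A O K M (fun i => thorpCipher f (M i)) ≤
      q * T * parityCost k α n (2 ^ (ℓ + m * q)) +
        𝔼 f : Query m T → ZMod 2, 𝔼 O : Oracle k m n T,
          ∑ i, ∑ r, ind (visit f (M i) r ∈ A.queried O) := by
  have hcost := (adapted_explore M).expect_empty_sub_visited_le (dependsOn_hybridProb A M)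
    (fun x => add_nonneg (parityCost_nonneg hk _) (expect_nonneg fun O _ => ind_nonneg _))
    fun V f x hx => expect_hybridProb_sub_insert_le hk A M V f hx
  simp only [hybridProb_empty, hybridProb_visited, Fintype.expect_const, ← expect_sum_comm,
    sum_explore M _ fun x => parityCost k α n (2 ^ (ℓ + m * q)) + 𝔼 O, ind (x ∈ A.queried O)]
    at hcost
  simpa only [sum_add_distrib, sum_const, card_univ, Fintype.card_fin, nsmul_eq_mul,
    ← mul_assoc, expect_add_distrib, Fintype.expect_const, ← expect_sum_comm] using hcost

theorem expect_cipher_sub_expect_thorpCipher_le [NeZero k] {α : ℕ} (hk : α + n ≤ k)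
    (A : DetAdversary k m n ℓ q Q T) [Nonempty (Fin q ↪ Bits m)] :
    𝔼 M : Fin q ↪ Bits m, (𝔼 O : Oracle k m n T, 𝔼 K : Bits k,
        accept A O K M (fun i => cipher O K (M i)) -
      𝔼 f : Query m T → ZMod 2, 𝔼 O : Oracle k m n T, 𝔼 K : Bits k,
        accept A O K M (fun i => thorpCipher f (M i))) ≤
      q * T * parityCost k α n (2 ^ (ℓ + m * q)) + q * Q / 2 ^ (m - 1) := by
  have hvisits : ∀ (f : Query m T → ZMod 2) (O : Oracle k m n T),
      𝔼 M : Fin q ↪ Bits m, ∑ i, ∑ r, ind (visit f (M i) r ∈ A.queried O) ≤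
        q * Q / 2 ^ (m - 1) := fun f O => by
    simp only [expect_sum_comm]
    refine (sum_expect_visit_mem_le (A.queried O) f).trans ?_
    gcongr
    exact A.card_queried_le O
  calc _ ≤ 𝔼 M : Fin q ↪ Bits m, (q * T * parityCost k α n (2 ^ (ℓ + m * q)) +
        𝔼 f : Query m T → ZMod 2, 𝔼 O : Oracle k m n T,
          ∑ i, ∑ r, ind (visit f (M i) r ∈ A.queried O)) :=
        expect_le_expect fun M _ => expect_cipher_sub_expect_thorpCipher_le_visits hk A M
    _ = q * T * parityCost k α n (2 ^ (ℓ + m * q)) +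
        𝔼 f : Query m T → ZMod 2, 𝔼 O : Oracle k m n T, 𝔼 M : Fin q ↪ Bits m,
          ∑ i, ∑ r, ind (visit f (M i) r ∈ A.queried O) := by
        rw [expect_add_distrib, Fintype.expect_const, ← expect_rotate]
    _ ≤ q * T * parityCost k α n (2 ^ (ℓ + m * q)) + q * Q / 2 ^ (m - 1) := by
        gcongr
        exact expect_le univ_nonempty fun f _ => expect_le univ_nonempty fun O _ => hvisits f O

theorem expect_thorpCipher_sub_expect_perm_le {s : ℕ} (hT : T = s * (2 * m - 1))
    (M : Fin q ↪ Bits m) {u : (Fin q → Bits m) → ℝ} (hu : ∀ C, u C ∈ Set.Icc (0 : ℝ) 1) :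
    𝔼 f : Query m T → ZMod 2, u (fun i => thorpCipher f (M i)) -
      𝔼 π : Equiv.Perm (Bits m), u (fun i => π (M i)) ≤
        (q : ℝ) / (s + 1) * (4 * m * q / 2 ^ m) ^ s := by
  have hmarkov := expect_thorpCipher_eq_markovOp (T := T) (fun X => u fun i => X (M i)) 1
  simp only [Function.comp_apply, Equiv.Perm.one_apply] at hmarkov
  rw [hmarkov, hT]
  exact markovOp_thorpStep_sub_expect_le M s (fun _ => hu _) fun _ _ heq =>
    congrArg u (funext heq)

theorem expect_accept_sub_le [NeZero k] {s α : ℕ} (hT : T = s * (2 * m - 1)) (hk : α + n ≤ k)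
    (A : DetAdversary k m n ℓ q Q T) [Nonempty (Fin q ↪ Bits m)] :
    𝔼 O : Oracle k m n T, 𝔼 K : Bits k, 𝔼 M : Fin q ↪ Bits m,
        accept A O K M (fun i => cipher O K (M i)) -
      𝔼 O : Oracle k m n T, 𝔼 K : Bits k, 𝔼 M : Fin q ↪ Bits m,
        𝔼 π : Equiv.Perm (Bits m), accept A O K M (fun i => π (M i)) ≤
      (q : ℝ) / (s + 1) * (4 * m * q / 2 ^ m) ^ s +
        (q * T * parityCost k α n (2 ^ (ℓ + m * q)) + q * Q / 2 ^ (m - 1)) := by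
  have hideal : 𝔼 M : Fin q ↪ Bits m, (𝔼 f : Query m T → ZMod 2, 𝔼 O : Oracle k m n T,
        𝔼 K : Bits k, accept A O K M (fun i => thorpCipher f (M i)) -
      𝔼 O : Oracle k m n T, 𝔼 K : Bits k, 𝔼 π : Equiv.Perm (Bits m),
        accept A O K M (fun i => π (M i))) ≤ (q : ℝ) / (s + 1) * (4 * m * q / 2 ^ m) ^ s := by
    refine expect_le univ_nonempty fun M _ => ?_
    rw [← expect_rotate]
    simp only [← expect_sub_distrib]
    exact expect_le univ_nonempty fun O _ => expect_le univ_nonempty fun K _ =>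
      expect_thorpCipher_sub_expect_perm_le hT M (accept_mem_Icc A O K M)
  have hreal := expect_cipher_sub_expect_thorpCipher_le hk A
  simp only [← expect_sub_distrib]
  rw [expect_rotate]
  simp only [expect_sub_distrib] at hideal hreal ⊢
  linarith

end Advantage

/-! ### From probability mass functions to averages -/

theorem toReal_uniformOfFintype_bind {β γ : Type*} [Fintype β] [Nonempty β] (p : β → PMF γ)
    (c : γ) : ((PMF.uniformOfFintype β).bind p c).toReal = 𝔼 b, (p b c).toReal := by
  rw [PMF.bind_apply, tsum_fintype,
    ENNReal.toReal_sum fun b _ => ENNReal.mul_ne_top (PMF.apply_ne_top _ _) (PMF.apply_ne_top _ _),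
    Fintype.expect_eq_sum_div_card, div_eq_inv_mul, mul_sum]
  refine sum_congr rfl fun b _ => ?_
  simp [PMF.uniformOfFintype_apply]

theorem toReal_pure_true (b : Bool) : (PMF.pure b true).toReal = ind (b = true) := by
  cases b <;> simp [ind, PMF.pure_apply]

theorem toReal_bind_sub_le {β γ : Type*} (p : PMF β) {f g : β → PMF γ} {c : γ} {B : ℝ}
    (hB : 0 ≤ B) (hfg : ∀ b, (f b c).toReal - (g b c).toReal ≤ B) :
    (p.bind f c).toReal - (p.bind g c).toReal ≤ B := by
  have hle : ∀ b, f b c ≤ g b c + ENNReal.ofReal B := fun b => by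
    rw [← ENNReal.ofReal_toReal (PMF.apply_ne_top (f b) c),
      ← ENNReal.ofReal_toReal (PMF.apply_ne_top (g b) c),
      ← ENNReal.ofReal_add ENNReal.toReal_nonneg hB]
    exact ENNReal.ofReal_le_ofReal (sub_le_iff_le_add'.1 (hfg b))
  have hbind : p.bind f c ≤ p.bind g c + ENNReal.ofReal B :=
    calc ∑' b, p b * f b c ≤ ∑' b, (p b * g b c + p b * ENNReal.ofReal B) :=
          ENNReal.tsum_le_tsum fun b => by rw [← mul_add]; gcongr; exact hle b
      _ = p.bind g c + ENNReal.ofReal B := by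
          rw [ENNReal.tsum_add, ENNReal.tsum_mul_right, p.tsum_coe, one_mul, PMF.bind_apply]
  have htoReal := ENNReal.toReal_mono
    (ENNReal.add_ne_top.2 ⟨PMF.apply_ne_top _ _, ENNReal.ofReal_ne_top⟩) hbind
  rw [ENNReal.toReal_add (PMF.apply_ne_top _ _) ENNReal.ofReal_ne_top, ENNReal.toReal_ofReal hB]
    at htoReal
  linarith

theorem div_two_mul_two_pow_div_le {c : ℝ} (hc : 0 ≤ c) {e m α : ℕ} (hα : e + m ≤ α) :
    c / 2 * (2 ^ e / 2 ^ α) ≤ c / 2 ^ m :=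
  calc c / 2 * (2 ^ e / 2 ^ α) ≤ c * (2 ^ e / 2 ^ (e + m)) := by
        gcongr
        exacts [half_le_self hc, one_le_two]
    _ = c / 2 ^ m := by rw [pow_add]; field_simp

end BigKeyThorp

end

theorem theorem1_general (k m n ℓ q Q s T α : ℕ) [NeZero k] (hm : 1 ≤ m) (hq : q ≤ 2 ^ m)
    (hT : T = s * (2 * m - 1)) (hk : α + n ≤ k) :
    BigKeyThorp.maxAdv k m n ℓ q Q T hq ≤
      (q : ℝ) / (s + 1) * (4 * m * q / 2 ^ m) ^ s
        + q * T / 2 * BigKeyThorp.hInv (1 - ((α : ℝ) + n) / k) ^ ((n : ℝ) / 2)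
        + q * Q / 2 ^ (m - 1)
        + q * T / 2 * (2 ^ (ℓ + m * q) / 2 ^ α) := by
  have : NeZero m := ⟨Nat.one_le_iff_ne_zero.1 hm⟩
  have := BigKeyThorp.nonempty_messages hq
  have := BigKeyThorp.hInv_entropyRate_nonneg hk
  refine Real.iSup_le (fun 𝒜 => ?_) (by positivity)
  refine BigKeyThorp.toReal_bind_sub_le 𝒜 (by positivity) fun A => ?_
  simp only [BigKeyThorp.randomMessages, BigKeyThorp.toReal_uniformOfFintype_bind,
    BigKeyThorp.toReal_pure_true]
  refine (BigKeyThorp.expect_accept_sub_le hT hk A).trans_eq ?_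
  rw [BigKeyThorp.parityCost]
  push_cast
  ring

theorem theorem1 (k m n ℓ q Q s T α : ℕ) [NeZero k] (hm : 1 ≤ m) (hq : q ≤ 2 ^ m)
    (hT : T = s * (2 * m - 1)) (hα : α = ℓ + m * (q + 1) + T) (hk : α + n ≤ k) :
    BigKeyThorp.maxAdv k m n ℓ q Q T hq ≤
      (q : ℝ) / (s + 1) * (4 * m * q / 2 ^ m) ^ s
        + q * T / 2 * BigKeyThorp.hInv (1 - ((α : ℝ) + n) / k) ^ ((n : ℝ) / 2)
        + q * Q / 2 ^ (m - 1)
        + q * T / 2 ^ m := by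
  refine (theorem1_general k m n ℓ q Q s T α hm hq hT hk).trans (add_le_add_right ?_ _)
  exact BigKeyThorp.div_two_mul_two_pow_div_le (by positivity) (by rw [hα, mul_add_one]; omega)
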